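/- For polynomial vectors $A,B\in\mathbb R[t]^n$ that are linearly independent over $\mathbb R[t]$ let $\langle A,B\rangle=\{v\in\mathbb R[t]^n : v=aA+bB,\ a,b\in\mathbb R(t)\}$; linearly independent $A,B$ are called quasi-generators of the module $\langle A,B\rangle$. Let $A\wedge B=(A_iB_j-A_jB_i)_{i<j}$, let the degree of a polynomial vector be the maximal degree of its entries, and let $\gcd(A\wedge B)$ be the greatest common divisor of the entries of $A\wedge B$. Put $\deg M=\min\deg(\tilde A\wedge\tilde B)$ over all pairs of quasi-generators $\tilde A,\tilde B$ of $M$; a $\mu$-basis of $M$ is a pair of quasi-generators $\tilde A,\tilde B$ of $M$ with $\deg\tilde A+\deg\tilde B=\deg M$. For $t\in\mathbb P^1(\mathbb R)=\mathbb R\cup\{\infty\}$ let $L(M,t)=\{x\in\mathbb R^n : A(t)\cdot x=0\text{ for all }A\in M\}$, where $A(\infty)$ is the leading coefficient vector of $A$, and let $\mathcal S_M=\bigcup_t\mathbb P(L(M,t))\subset\mathbb P(\mathbb R^n)$. Let $e_0,\dots,e_4\in\mathbb R[t]$, $\langle v,w\rangle=v_1w_1+v_2w_2+v_3w_3-v_4w_4$,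 $e=(e_1,\dots,e_4)$, $$\hat{\mathcal E}=(\langle e,e\rangle,\ e_0^2,\ e_0e_1,\ e_0e_2,\ e_0e_3,\ e_0e_4),\qquad E=\hat{\mathcal E}C=\bigl(-\tfrac12e_0^2,\,-\tfrac12\langle e,e\rangle,\,e_0e_1,\,e_0e_2,\,e_0e_3,\,-e_0e_4\bigr),$$ where $C$ is the matrix of the Lie scalar product $-\tfrac12(x_1z_2+x_2z_1)+x_3z_3+x_4z_4+x_5z_5-x_6z_6$, let $E'$ be the derivative of $E$, and let $\mathcal V(\hat{\mathcal E})=\mathcal S_{\langle E,E'\rangle}\subset\mathbb P^5$ be the dual variety. Assume that $E,E'$ are linearly independent over $\mathbb R[t]$ and that the rational map $t\mapsto (E\wedge E')(t)$ to projective space is not constant. Let $k$ be the degree of this map, i.e. the number of complex parameters in a generic fibre. Then $k$ is a (well-defined) positive integer, and the ideal of all polynomials in $\hat y=(u,y_0,y_1,y_2,y_3,y_4)$ over $\mathbb R$ that vanish on $\mathcal V(\hat{\mathcal E})$ is generated by one nonzero polynomial $F_{\mathcal V(\hat{\mathcal E})}$ (the implicit equation, unique up to a nonzero constant factor, whose degree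 is $\deg\mathcal V(\hat{\mathcal E})$). For every $\mu$-basis $E_1,E_2$ of $\langle E,E'\rangle$, $$k\cdot\deg\mathcal V(\hat{\mathcal E})=\deg E_1+\deg E_2=\deg(E\wedge E')-\deg\gcd(E\wedge E'),$$ and, up to a nonzero real constant factor, $$\mathrm{Res}_t(E_1\cdot\hat y^T,E_2\cdot\hat y^T)=F_{\mathcal V(\hat{\mathcal E})}^{\,k}.$$ For every $d\in\mathbb R$ the same holds, under the same assumptions, for $$D=\bigl(-\tfrac12e_0^2,\,-\tfrac12\langle e,e\rangle+d\,e_0e_4,\,e_0e_1,\,e_0e_2,\,e_0e_3\bigr)$$ and its derivative $D'$ in place of $E,E'$, the offset dual variety $\mathcal V_d(\hat{\mathcal E})=\mathcal S_{\langle D,D'\rangle}\subset\mathbb P^4$ in place of $\mathcal V(\hat{\mathcal E})$, the variables $(u,y_0,y_1,y_2,y_3)$ in place of $\hat y$, the degree $k$ of the parametrization $t\mapsto (D\wedge D')(t)$, and every $\mu$-basis $D_1,D_2$ of $\langle D,D'\rangle$. -/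

import Mathlib

open Polynomial

noncomputable section

namespace CanalSurface

/-! ### Modules with two quasi-generators -/

/-- The degree of a polynomial vector: the maximal degree of an entry. -/
def vecDegree {ι : Type*} [Fintype ι] (A : ι → ℝ[X]) : ℕ :=
  Finset.univ.sup fun i => (A i).natDegree

/-- The leading vector `LV(A)`: the vector of coefficients of `t ^ deg A`. -/
def leadVec {ι : Type*} [Fintype ι] (A : ι → ℝ[X]) : ι → ℝ :=
  fun i => (A i).coeff (vecDegree A)

/-- The module `⟨A, B⟩`: all polynomial vectors of the form `a A + b B` with coefficients `a`, `b`
in the field `ℝ(t)` of rational functions. -/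
def quasiSpan {n : ℕ} (A B : Fin n → ℝ[X]) : Submodule ℝ[X] (Fin n → ℝ[X]) where
  carrier := {v | ∃ a b : RatFunc ℝ, ∀ i,
    algebraMap ℝ[X] (RatFunc ℝ) (v i) =
      a * algebraMap ℝ[X] (RatFunc ℝ) (A i) + b * algebraMap ℝ[X] (RatFunc ℝ) (B i)}
  zero_mem' := ⟨0, 0, fun i => by simp⟩
  add_mem' := by
    rintro v w ⟨a, b, h⟩ ⟨a', b', h'⟩
    refine ⟨a + a', b + b', fun i => ?_⟩
    rw [Pi.add_apply, map_add, h, h']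
    ring
  smul_mem' := by
    rintro p v ⟨a, b, h⟩
    refine ⟨algebraMap ℝ[X] (RatFunc ℝ) p * a, algebraMap ℝ[X] (RatFunc ℝ) p * b, fun i => ?_⟩
    rw [Pi.smul_apply, smul_eq_mul, map_mul, h]
    ring

/-- `A`, `B` are quasi-generators of `M`: they are `ℝ[t]`-linearly independent and
`⟨A, B⟩ = M`. -/
def IsQuasiGenerators {n : ℕ} (M : Submodule ℝ[X] (Fin n → ℝ[X])) (A B : Fin n → ℝ[X]) : Prop :=
  LinearIndependent ℝ[X] ![A, B] ∧ quasiSpan A B = M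

/-- The Plücker coordinate vector `A ∧ B`: the vector of the `2`-minors
`[i, j] = A_i B_j - A_j B_i`, `i < j`. -/
def wedge {n : ℕ} (A B : Fin n → ℝ[X]) : {p : Fin n × Fin n // p.1 < p.2} → ℝ[X] :=
  fun p => A p.1.1 * B p.1.2 - A p.1.2 * B p.1.1

/-- The degree of a module with two quasi-generators: the minimum of `deg (A ∧ B)` over all pairs
of quasi-generators. -/
def moduleDegree {n : ℕ} (M : Submodule ℝ[X] (Fin n → ℝ[X])) : ℕ :=
  sInf {m | ∃ A B : Fin n → ℝ[X], IsQuasiGenerators M A B ∧ vecDegree (wedge A B) = m}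

/-- A `μ`-basis of `M`: quasi-generators with `deg M = deg A + deg B`. -/
def IsMuBasis {n : ℕ} (M : Submodule ℝ[X] (Fin n → ℝ[X])) (A B : Fin n → ℝ[X]) : Prop :=
  IsQuasiGenerators M A B ∧ moduleDegree M = vecDegree A + vecDegree B

/-- A greatest common divisor (unique up to a unit) of the entries of a polynomial vector: a
generator of the ideal that they span in the principal ideal domain `ℝ[t]`. -/
def vecGcd {ι : Type*} (P : ι → ℝ[X]) : ℝ[X] :=
  Submodule.IsPrincipal.generator (Ideal.span (Set.range P))

/-! ### The parametrization given by a polynomial vector -/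

/-- The rational map `t ↦ (P_i(t))_i` to projective space is not constant, i.e. its image is a
curve: `P` is not a (possibly zero) polynomial times a constant vector. In particular `P ≠ 0`. -/
def IsNonconstantMap {ι : Type*} (P : ι → ℝ[X]) : Prop :=
  ¬ ∃ (h : ℝ[X]) (v : ι → ℝ), ∀ i, P i = h * C (v i)

/-- `k` is the degree of the parametrization `t ↦ (P_i(t))_i`: for all but finitely many complex
`t₀`, exactly `k` complex parameters have the same image as `t₀` in complex projective space.
The point at infinity and the common zeros of the `P_i` influence only the fibres of finitely many
points, so they play no role here. If the map is constant, its fibres are infinite and there is no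
such `k`. -/
def IsParamDegree {ι : Type*} (P : ι → ℝ[X]) (k : ℕ) : Prop :=
  ∀ᶠ t₀ : ℂ in Filter.cofinite,
    {t : ℂ | (∃ i, aeval t (P i) ≠ 0) ∧
      ∃ c : ℂ, ∀ i, aeval t (P i) = c * aeval t₀ (P i)}.encard = k

/-! ### The hypersurface of a module and its implicit equation -/

/-- The value of a polynomial vector at a point of `ℙ¹(ℝ) = ℝ ∪ {∞}`; at infinity, where the
homogenized vector is evaluated at `(1 : 0)`, this is the leading vector. -/
def valueAt {n : ℕ} (A : Fin n → ℝ[X]) (t : OnePoint ℝ) : Fin n → ℝ :=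
  t.elim (leadVec A) fun s i => (A i).eval s

/-- `L(M, t) = {x ∈ ℝⁿ | A(t) · x = 0 for all A ∈ M}`. -/
def fibreSpace {n : ℕ} (M : Submodule ℝ[X] (Fin n → ℝ[X])) (t : OnePoint ℝ) :
    Submodule ℝ (Fin n → ℝ) where
  carrier := {x | ∀ A ∈ M, valueAt A t ⬝ᵥ x = 0}
  zero_mem' := fun A _ => dotProduct_zero _
  add_mem' := fun hx hy A hA => by rw [dotProduct_add, hx A hA, hy A hA, add_zero]
  smul_mem' := fun c x hx A hA => by rw [dotProduct_smul, hx A hA, smul_zero]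

/-- `S_M`, the union over `t ∈ ℙ¹(ℝ)` of the projective subspaces `ℙ(L(M, t))` of
`ℙⁿ⁻¹ = ℙ(ℝⁿ)`. -/
def ruledHypersurface {n : ℕ} (M : Submodule ℝ[X] (Fin n → ℝ[X])) :
    Set (Projectivization ℝ (Fin n → ℝ)) :=
  {p | ∃ t : OnePoint ℝ, p.submodule ≤ fibreSpace M t}

/-- `F` is the implicit equation of the hypersurface `S` in real projective space: `F ≠ 0` and `F`
generates the ideal of all polynomials vanishing on `S`. So `F` is determined up to a nonzero
constant factor, and the degree of the hypersurface is the total degree of `F`. -/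
def IsImplicitEquation {n : ℕ} (S : Set (Projectivization ℝ (Fin n → ℝ)))
    (F : MvPolynomial (Fin n) ℝ) : Prop :=
  F ≠ 0 ∧
    MvPolynomial.vanishingIdeal ℝ
      {x : Fin n → ℝ | ∃ hx : x ≠ 0, Projectivization.mk ℝ x hx ∈ S} = Ideal.span {F}

/-- `A(t) · x` as a polynomial in `t` with coefficients in `ℝ[x_1, …, x_n]`. -/
def linForm {n : ℕ} (A : Fin n → ℝ[X]) : (MvPolynomial (Fin n) ℝ)[X] :=
  ∑ i, (A i).map MvPolynomial.C * C (MvPolynomial.X i)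

/-! ### The spine curve, its pre-image in the Lie quadric and the dual varieties -/

/-- The Lorentz product `v_1 w_1 + v_2 w_2 + v_3 w_3 - v_4 w_4` of the last four entries of two
vectors `(v_0, …, v_4)`, `(w_0, …, w_4)`. -/
def lorentz (v w : Fin 5 → ℝ[X]) : ℝ[X] :=
  v 1 * w 1 + v 2 * w 2 + v 3 * w 3 - v 4 * w 4

/-- The parametrization `(⟨e, e⟩ : e_0² : e_0 e_1 : e_0 e_2 : e_0 e_3 : e_0 e_4)` of the pre-image
in the Lie quadric of the spine curve `(e_0 : e_1 : e_2 : e_3 : e_4)`. -/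
def lieCurve (e : Fin 5 → ℝ[X]) : Fin 6 → ℝ[X] :=
  ![lorentz e e, e 0 ^ 2, e 0 * e 1, e 0 * e 2, e 0 * e 3, e 0 * e 4]

/-- The matrix `C` of the Lie scalar product
`-(x_1 z_2 + x_2 z_1) / 2 + x_3 z_3 + x_4 z_4 + x_5 z_5 - x_6 z_6`. -/
def lieMatrix : Matrix (Fin 6) (Fin 6) ℝ :=
  !![0, -1/2, 0, 0, 0, 0;
     -1/2, 0, 0, 0, 0, 0;
     0, 0, 1, 0, 0, 0;
     0, 0, 0, 1, 0, 0;
     0, 0, 0, 0, 1, 0;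
     0, 0, 0, 0, 0, -1]

/-- `E = (lieCurve e) C`. -/
def vecE (e : Fin 5 → ℝ[X]) : Fin 6 → ℝ[X] :=
  Matrix.vecMul (lieCurve e) (lieMatrix.map C)

/-- `D`, obtained from the linear form `E · (u, y_0, y_1, y_2, y_3, y_4)` by the substitution
`y_4 = -d y_0`. -/
def vecD (e : Fin 5 → ℝ[X]) (d : ℝ) : Fin 5 → ℝ[X] :=
  ![-(C (1 / 2) * e 0 ^ 2), -(C (1 / 2) * lorentz e e) + C d * (e 0 * e 4),
    e 0 * e 1, e 0 * e 2, e 0 * e 3]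

/-- The entrywise derivative of a polynomial vector. -/
def vecDeriv {ι : Type*} (A : ι → ℝ[X]) : ι → ℝ[X] :=
  fun i => derivative (A i)

/-- The module `⟨E, E'⟩`. -/
def moduleE (e : Fin 5 → ℝ[X]) : Submodule ℝ[X] (Fin 6 → ℝ[X]) :=
  quasiSpan (vecE e) (vecDeriv (vecE e))

/-- The module `⟨D, D'⟩`. -/
def moduleD (e : Fin 5 → ℝ[X]) (d : ℝ) : Submodule ℝ[X] (Fin 5 → ℝ[X]) :=
  quasiSpan (vecD e d) (vecDeriv (vecD e d))

/-- The dual variety of the curve `lieCurve e`. -/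
def dualVariety (e : Fin 5 → ℝ[X]) : Set (Projectivization ℝ (Fin 6 → ℝ)) :=
  ruledHypersurface (moduleE e)

/-- The offset dual variety at distance `d`. -/
def offsetDualVariety (e : Fin 5 → ℝ[X]) (d : ℝ) : Set (Projectivization ℝ (Fin 5 → ℝ)) :=
  ruledHypersurface (moduleD e d)

end CanalSurface

end

open Polynomial

noncomputable section

namespace CanalSurface

/-! Both halves are instances, for `A = E` and `A = D`, of one statement about a curve `A` with
non-constant tangent line; the Lie geometry plays no role in the argument.

Algebraic side. The module `⟨A, A'⟩` has quasi-generators `P`, `Q` that are independent at every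
parameter and also at infinity (`IsRegularPair`); every `μ`-basis is such a pair. Over `ℂ` the
resultant `R` of `P · x` and `Q · x` therefore vanishes exactly on the union of the fibres over
`ℙ¹(ℂ)`, and it is homogeneous of degree `deg P + deg Q`. The fibres are parametrized by polynomials
in `t` and free parameters `y` (`paramVec`). This makes the ideal of the real hypersurface prime and
transfers vanishing from real fibres to fibres over any `ℝ`-algebra. With the Nullstellensatz, the
ideal is generated by a prime `F`, and `R = c F ^ m` (`IsRegularPair.exists_prime`,
`IsRegularPair.exists_resultant_eq`).

Geometric side: `m` is the degree of `t ↦ A ∧ A'`. Take a generic complex point `x` of a generic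
fibre and a generic line through it. There `F` vanishes to order one, so `R` vanishes to order `m`;
an identity between resultants (`exists_resultant_pencil_eq`) shows that this order is the number of
common roots of `P · x` and `Q · x`, i.e. the number of fibres through `x`
(`IsDualFrame.card_fibres_eq`). By reflexivity all these fibres belong to one tangent line: the
gradient of `F` at `x` is proportional to `A(t)`, and its derivative along the hypersurface recovers
`A'(t)` modulo `A(t)` (`IsDualFrame.exists_minor_eq`). Hence the fibres through `x` correspond to
the parameters with the same Plücker point.

Non-constancy of the tangent line enters through `exists_isDualFrame`: it makes `A`, `A'`, `A''`
independent over `ℝ(t)`. -/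

/-! ### Minors and Wronskians -/

/-- The `2`-minor of two vectors with respect to a pair of indices. -/
def minor {ι R : Type*} [CommRing R] (U V : ι → R) (i j : ι) : R := U i * V j - U j * V i

theorem minor_swap {ι R : Type*} [CommRing R] (U V : ι → R) (i j : ι) :
    minor U V j i = -minor U V i j := by
  simp only [minor]; ring

theorem exists_wedge_ne_zero {n : ℕ} {U V : Fin n → ℝ[X]} {i j : Fin n}
    (h : minor U V i j ≠ 0) : ∃ p, wedge U V p ≠ 0 := by
  rcases lt_trichotomy i j with hij | hij | hij
  · exact ⟨⟨(i, j), hij⟩, h⟩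
  · subst hij
    exact absurd (sub_self _) h
  · refine ⟨⟨(j, i), hij⟩, fun h0 => h ?_⟩
    rw [minor_swap]
    exact neg_eq_zero.2 h0

theorem exists_minor_ne_zero {n : ℕ} {U V : Fin n → ℝ[X]} (h : wedge U V ≠ 0) :
    ∃ i j, minor U V i j ≠ 0 := by
  obtain ⟨p, hp⟩ := Function.ne_iff.1 h
  exact ⟨p.1.1, p.1.2, hp⟩

/-- Two real polynomials with vanishing Wronskian are proportional. -/
theorem eq_mul_C_of_wronskian_eq_zero {f g : ℝ[X]} (hf : f ≠ 0)
    (h : f * derivative g = derivative f * g) : ∃ c : ℝ, g = f * C c := by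
  -- Dividing by the gcd `d` scales the Wronskian by `d ^ 2`; for coprime polynomials a zero
  -- Wronskian forces both derivatives to vanish.
  obtain ⟨d, a, b, hab, ha, hb⟩ : ∃ d a b : ℝ[X], IsCoprime a b ∧ f = a * d ∧ g = b * d := by
    obtain ⟨a, ha⟩ := EuclideanDomain.gcd_dvd_left f g
    obtain ⟨b, hb⟩ := EuclideanDomain.gcd_dvd_right f g
    have hd : EuclideanDomain.gcd f g ≠ 0 :=
      fun h0 => hf (EuclideanDomain.gcd_eq_zero_iff.1 h0).1
    have hbez := EuclideanDomain.gcd_eq_gcd_ab f g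
    generalize EuclideanDomain.gcd f g = d at *
    generalize EuclideanDomain.gcdA f g = x at *
    generalize EuclideanDomain.gcdB f g = y at *
    refine ⟨d, a, b, ⟨x, y, mul_left_cancel₀ hd ?_⟩, by rw [ha, mul_comm], by rw [hb, mul_comm]⟩
    rw [ha, hb] at hbez
    linear_combination -hbez
  have hd : d ≠ 0 := by
    rintro h0
    exact hf (by rw [ha, h0, mul_zero])
  have hw : wronskian a b = 0 := by
    have : d ^ 2 * wronskian a b = 0 := by
      rw [ha, hb, derivative_mul, derivative_mul] at h
      rw [wronskian]
      linear_combination h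
    exact (mul_eq_zero.1 this).resolve_left (pow_ne_zero _ hd)
  obtain ⟨h1, h2⟩ := (IsCoprime.wronskian_eq_zero_iff hab).1 hw
  obtain ⟨x, hx⟩ := natDegree_eq_zero.1 (derivative_eq_zero.1 h1)
  obtain ⟨y, hy⟩ := natDegree_eq_zero.1 (derivative_eq_zero.1 h2)
  have hx0 : x ≠ 0 := by
    rintro rfl
    exact hf (by rw [ha, ← hx, C_0, zero_mul])
  refine ⟨y / x, ?_⟩
  rw [hb, ha, ← hx, ← hy, mul_right_comm, ← C_mul, mul_div_cancel₀ _ hx0]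

/-! ### Dual frames of `A`, `A'`, `A''` -/

/-- Polynomial vectors that are dual, up to the common factor `δ`, to `A`, `A'`, `A''`. -/
structure IsDualFrame {n : ℕ} (A α β γ : Fin n → ℝ[X]) (δ : ℝ[X]) : Prop where
  ne_zero : δ ≠ 0
  aa : A ⬝ᵥ α = δ
  ab : A ⬝ᵥ β = 0
  ac : A ⬝ᵥ γ = 0
  ba : vecDeriv A ⬝ᵥ α = 0
  bb : vecDeriv A ⬝ᵥ β = δ
  bc : vecDeriv A ⬝ᵥ γ = 0
  ca : vecDeriv (vecDeriv A) ⬝ᵥ α = 0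
  cb : vecDeriv (vecDeriv A) ⬝ᵥ β = 0
  cc : vecDeriv (vecDeriv A) ⬝ᵥ γ = δ

theorem IsNonconstantMap.wedge_ne_zero {n : ℕ} {A B : Fin n → ℝ[X]}
    (h : IsNonconstantMap (wedge A B)) : wedge A B ≠ 0 := by
  intro h0
  exact h ⟨0, 0, fun i => by simp [h0]⟩

/-- If every `3 × 3` minor of `A`, `A'`, `A''` through the columns `i`, `j` vanished, the Plücker
vector and its derivative `A ∧ A''` would be proportional; all Wronskians of Plücker coordinates
would be zero and the tangent line constant. A nonzero minor is the factor `δ`, and the frame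
consists of its cofactors. -/
theorem exists_isDualFrame {n : ℕ} {A : Fin n → ℝ[X]}
    (h : IsNonconstantMap (wedge A (vecDeriv A))) :
    ∃ α β γ δ, IsDualFrame A α β γ δ := by
  classical
  set B := vecDeriv A with hB
  set D := vecDeriv B with hD
  obtain ⟨i, j, hij⟩ := exists_minor_ne_zero h.wedge_ne_zero
  have hl : ∃ l, A l * minor B D i j - B l * minor A D i j + D l * minor A B i j ≠ 0 := by
    by_contra! h0
    have key : ∀ k l : Fin n, minor A B i j * derivative (minor A B k l) =
        minor A D i j * minor A B k l := by
      intro k l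
      have hd : derivative (minor A B k l) = minor A D k l := by
        simp only [minor, derivative_sub, derivative_mul, hB, hD, vecDeriv]
        ring
      rw [hd]
      have e1 := h0 k
      have e2 := h0 l
      simp only [minor] at e1 e2 ⊢
      linear_combination A k * e2 - A l * e1
    apply h
    have hw : ∀ p : {p : Fin n × Fin n // p.1 < p.2},
        ∃ c : ℝ, wedge A B p = minor A B i j * C c := by
      intro p
      apply eq_mul_C_of_wronskian_eq_zero hij
      have e1 := key i j
      have e2 := key p.1.1 p.1.2
      change minor A B i j * derivative (minor A B p.1.1 p.1.2) =
        derivative (minor A B i j) * minor A B p.1.1 p.1.2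
      apply mul_left_cancel₀ hij
      linear_combination minor A B i j * e2 - minor A B p.1.1 p.1.2 * e1
    choose v hv using hw
    exact ⟨_, v, hv⟩
  obtain ⟨l, hl⟩ := hl
  have hdot : ∀ (U : Fin n → ℝ[X]) (a b c : ℝ[X]),
      U ⬝ᵥ (Pi.single i a + Pi.single j b + Pi.single l c) = U i * a + U j * b + U l * c := by
    intro U a b c
    simp [dotProduct_add]
  refine ⟨Pi.single i (minor B D j l) + Pi.single j (minor B D l i) + Pi.single l (minor B D i j),
    Pi.single i (minor D A j l) + Pi.single j (minor D A l i) + Pi.single l (minor D A i j),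
    Pi.single i (minor A B j l) + Pi.single j (minor A B l i) + Pi.single l (minor A B i j),
    _, hl, ?_, ?_, ?_, ?_, ?_, ?_, ?_, ?_, ?_⟩ <;>
  · rw [hdot]
    simp only [minor, ← hB, ← hD]
    ring

/-- A constant vector in the span of `A` and `A'` vanishes. -/
theorem IsDualFrame.eq_zero_of_const {n : ℕ} {A α β γ : Fin n → ℝ[X]} {δ : ℝ[X]}
    (h : IsDualFrame A α β γ δ) {K : Type*} [Field K] [Algebra ℝ K] {a b c : K[X]} (hc : c ≠ 0)
    {u : Fin n → K}
    (hu : ∀ i, c * C (u i) = a * (A i).map (algebraMap ℝ K) +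
      b * (derivative (A i)).map (algebraMap ℝ K)) : u = 0 := by
  set φ := mapRingHom (algebraMap ℝ K)
  have hdot : ∀ {U V : Fin n → ℝ[X]} {W : ℝ[X]}, U ⬝ᵥ V = W →
      ∑ i, φ (U i) * φ (V i) = φ W := by
    rintro U V W rfl
    simp [dotProduct, map_sum]
  have hδ : φ δ ≠ 0 := by
    simpa [φ] using h.ne_zero
  have hu' : ∀ i, c * C (u i) = a * φ (A i) + b * φ (derivative (A i)) := hu
  have hder : ∀ p : ℝ[X], derivative (φ p) = φ (derivative p) := fun p => by
    simp [φ, derivative_map]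
  have hd : ∀ i, derivative c * C (u i) = derivative a * φ (A i) +
      (a + derivative b) * φ (derivative (A i)) + b * φ (derivative (derivative (A i))) := by
    intro i
    have := congrArg derivative (hu' i)
    simp only [derivative_mul, derivative_add, derivative_C, mul_zero, add_zero, hder] at this
    rw [this]
    ring
  have dotu : ∀ V : Fin n → ℝ[X], c * ∑ i, C (u i) * φ (V i) =
      a * ∑ i, φ (A i) * φ (V i) + b * ∑ i, φ (vecDeriv A i) * φ (V i) := by
    intro V
    simp only [Finset.mul_sum, ← Finset.sum_add_distrib]
    refine Finset.sum_congr rfl fun i _ => ?_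
    rw [← mul_assoc, hu', vecDeriv]
    ring
  have dotd : ∀ V : Fin n → ℝ[X], derivative c * ∑ i, C (u i) * φ (V i) =
      derivative a * ∑ i, φ (A i) * φ (V i) + (a + derivative b) * ∑ i, φ (vecDeriv A i) * φ (V i)
        + b * ∑ i, φ (vecDeriv (vecDeriv A) i) * φ (V i) := by
    intro V
    simp only [Finset.mul_sum, ← Finset.sum_add_distrib]
    refine Finset.sum_congr rfl fun i _ => ?_
    rw [← mul_assoc, hd]
    simp only [vecDeriv]
    ring
  -- The relation paired with `γ` gives `u · γ = 0`, since `c ≠ 0`. The differentiated relation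
  -- paired with `γ` then reads `0 = b δ`. The same with `β` kills `a`.
  have hb : b = 0 := by
    have h1 := dotu γ
    have h2 := dotd γ
    rw [hdot h.ac, hdot h.bc, map_zero, mul_zero, mul_zero, add_zero] at h1
    rw [(mul_eq_zero.1 h1).resolve_left hc, hdot h.ac, hdot h.bc, hdot h.cc] at h2
    simpa [hδ] using h2.symm
  have ha : a = 0 := by
    have h1 := dotu β
    have h2 := dotd β
    rw [hdot h.ab, hdot h.bb, hb, map_zero, mul_zero, zero_mul, add_zero] at h1
    rw [(mul_eq_zero.1 h1).resolve_left hc, hdot h.ab, hdot h.bb, hdot h.cb, hb] at h2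
    simpa [hδ] using h2.symm
  funext i
  have := hu' i
  rw [ha, hb, zero_mul, zero_mul, add_zero] at this
  simpa [hc] using this

/-! ### Quasi-spans and quasi-generators -/

/-- Clearing denominators, so that everything below stays inside `ℝ[t]`. -/
theorem mem_quasiSpan_iff {n : ℕ} {A B U : Fin n → ℝ[X]} :
    U ∈ quasiSpan A B ↔ ∃ c a b : ℝ[X], c ≠ 0 ∧ ∀ i, c * U i = a * A i + b * B i := by
  have hinj := IsFractionRing.injective ℝ[X] (RatFunc ℝ)
  constructor
  · rintro ⟨a, b, h⟩
    obtain ⟨a₁, a₂, ha, rfl⟩ := IsFractionRing.div_surjective (A := ℝ[X]) a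
    obtain ⟨b₁, b₂, hb, rfl⟩ := IsFractionRing.div_surjective (A := ℝ[X]) b
    have ha0 := nonZeroDivisors.ne_zero ha
    have hb0 := nonZeroDivisors.ne_zero hb
    refine ⟨a₂ * b₂, a₁ * b₂, b₁ * a₂, mul_ne_zero ha0 hb0, fun i => hinj ?_⟩
    have h1 : algebraMap ℝ[X] (RatFunc ℝ) a₂ ≠ 0 := fun h0 => ha0 (hinj (by rw [h0, map_zero]))
    have h2 : algebraMap ℝ[X] (RatFunc ℝ) b₂ ≠ 0 := fun h0 => hb0 (hinj (by rw [h0, map_zero]))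
    simp only [map_mul, map_add, h i]
    field_simp
  · rintro ⟨c, a, b, hc, h⟩
    have h1 : algebraMap ℝ[X] (RatFunc ℝ) c ≠ 0 := fun h0 => hc (hinj (by rw [h0, map_zero]))
    refine ⟨algebraMap ℝ[X] _ a / algebraMap ℝ[X] _ c,
      algebraMap ℝ[X] _ b / algebraMap ℝ[X] _ c, fun i => ?_⟩
    have := congrArg (algebraMap ℝ[X] (RatFunc ℝ)) (h i)
    simp only [map_mul, map_add] at this
    field_simp
    linear_combination this

theorem linearIndependent_pair_iff {n : ℕ} {U V : Fin n → ℝ[X]} :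
    LinearIndependent ℝ[X] ![U, V] ↔ wedge U V ≠ 0 := by
  rw [LinearIndependent.pair_iff]
  constructor
  · intro h hw
    have hm : ∀ i j, minor U V i j = 0 := by
      intro i j
      by_contra hij
      obtain ⟨p, hp⟩ := exists_wedge_ne_zero hij
      exact hp (congrFun hw p)
    have hU : ∀ i, U i = 0 := fun i => (h (-V i) (U i) (by
      funext j
      have := hm i j
      simp only [minor] at this
      simp only [Pi.add_apply, Pi.smul_apply, smul_eq_mul, Pi.zero_apply]
      linear_combination this)).2
    exact one_ne_zero (h 1 0 (by funext j; simp [hU j])).1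
  · intro h a b hab
    obtain ⟨i, j, hij⟩ := exists_minor_ne_zero h
    have e : ∀ k, a * U k + b * V k = 0 := fun k => congrFun hab k
    constructor
    · refine (mul_eq_zero.1 (?_ : a * minor U V i j = 0)).resolve_right hij
      simp only [minor]
      linear_combination V j * e i - V i * e j
    · refine (mul_eq_zero.1 (?_ : b * minor U V i j = 0)).resolve_right hij
      simp only [minor]
      linear_combination U i * e j - U j * e i

theorem minor_comb {ι R : Type*} [CommRing R] {P Q U V : ι → R} {c c' a b a' b' : R}
    (hU : ∀ i, c * U i = a * P i + b * Q i) (hV : ∀ i, c' * V i = a' * P i + b' * Q i) (i j : ι) :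
    c * c' * minor U V i j = (a * b' - b * a') * minor P Q i j := by
  simp only [minor]
  linear_combination (c' * V j) * hU i - (c' * V i) * hU j + (a * P i + b * Q i) * hV j
    - (a * P j + b * Q j) * hV i

theorem left_mem_quasiSpan {n : ℕ} (A B : Fin n → ℝ[X]) : A ∈ quasiSpan A B :=
  mem_quasiSpan_iff.2 ⟨1, 1, 0, one_ne_zero, fun i => by ring⟩

theorem right_mem_quasiSpan {n : ℕ} (A B : Fin n → ℝ[X]) : B ∈ quasiSpan A B :=
  mem_quasiSpan_iff.2 ⟨1, 0, 1, one_ne_zero, fun i => by ring⟩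

/-- Two independent vectors of a plane over `ℝ(t)` span it; the inverse change of basis is Cramer's
rule with determinant `a₁ * b₂ - b₁ * a₂`. -/
theorem quasiSpan_eq_of_mem {n : ℕ} {A B U V : Fin n → ℝ[X]} (hU : U ∈ quasiSpan A B)
    (hV : V ∈ quasiSpan A B) (hw : wedge U V ≠ 0) : quasiSpan U V = quasiSpan A B := by
  obtain ⟨c₁, a₁, b₁, hc₁, h₁⟩ := mem_quasiSpan_iff.1 hU
  obtain ⟨c₂, a₂, b₂, hc₂, h₂⟩ := mem_quasiSpan_iff.1 hV
  obtain ⟨i, j, hij⟩ := exists_minor_ne_zero hw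
  have hdet : a₁ * b₂ - b₁ * a₂ ≠ 0 := by
    intro h0
    have := minor_comb h₁ h₂ i j
    rw [h0, zero_mul] at this
    exact mul_ne_zero (mul_ne_zero hc₁ hc₂) hij this
  ext W
  rw [mem_quasiSpan_iff, mem_quasiSpan_iff]
  constructor
  · rintro ⟨c, a, b, hc, h⟩
    refine ⟨c * (c₁ * c₂), a * c₂ * a₁ + b * c₁ * a₂, a * c₂ * b₁ + b * c₁ * b₂,
      mul_ne_zero hc (mul_ne_zero hc₁ hc₂), fun i => ?_⟩
    linear_combination (c₁ * c₂) * h i + a * c₂ * h₁ i + b * c₁ * h₂ i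
  · rintro ⟨c, a, b, hc, h⟩
    refine ⟨c * (a₁ * b₂ - b₁ * a₂), (a * b₂ - b * a₂) * c₁, (b * a₁ - a * b₁) * c₂,
      mul_ne_zero hc hdet, fun i => ?_⟩
    linear_combination (a₁ * b₂ - b₁ * a₂) * h i - (a * b₂ - b * a₂) * h₁ i
      - (b * a₁ - a * b₁) * h₂ i

theorem IsQuasiGenerators.wedge_ne_zero {n : ℕ} {M : Submodule ℝ[X] (Fin n → ℝ[X])}
    {P Q : Fin n → ℝ[X]} (h : IsQuasiGenerators M P Q) : wedge P Q ≠ 0 :=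
  linearIndependent_pair_iff.1 h.1

theorem IsQuasiGenerators.left_mem {n : ℕ} {M : Submodule ℝ[X] (Fin n → ℝ[X])}
    {P Q : Fin n → ℝ[X]} (h : IsQuasiGenerators M P Q) : P ∈ M :=
  h.2 ▸ left_mem_quasiSpan P Q

theorem IsQuasiGenerators.right_mem {n : ℕ} {M : Submodule ℝ[X] (Fin n → ℝ[X])}
    {P Q : Fin n → ℝ[X]} (h : IsQuasiGenerators M P Q) : Q ∈ M :=
  h.2 ▸ right_mem_quasiSpan P Q

theorem IsQuasiGenerators.of_mem {n : ℕ} {M : Submodule ℝ[X] (Fin n → ℝ[X])}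
    {P Q U V : Fin n → ℝ[X]} (h : IsQuasiGenerators M P Q) (hU : U ∈ M) (hV : V ∈ M)
    (hw : wedge U V ≠ 0) : IsQuasiGenerators M U V := by
  obtain ⟨-, rfl⟩ := h
  exact ⟨linearIndependent_pair_iff.2 hw, quasiSpan_eq_of_mem hU hV hw⟩

theorem wedge_swap {n : ℕ} (P Q : Fin n → ℝ[X]) : wedge Q P = -wedge P Q := by
  funext p
  simp only [wedge, Pi.neg_apply]
  ring

theorem IsQuasiGenerators.swap {n : ℕ} {M : Submodule ℝ[X] (Fin n → ℝ[X])}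
    {P Q : Fin n → ℝ[X]} (h : IsQuasiGenerators M P Q) : IsQuasiGenerators M Q P :=
  h.of_mem h.right_mem h.left_mem (by rw [wedge_swap]; exact neg_ne_zero.2 h.wedge_ne_zero)

/-! ### Degrees and leading vectors -/

theorem natDegree_le_vecDegree {ι : Type*} [Fintype ι] (A : ι → ℝ[X]) (i : ι) :
    (A i).natDegree ≤ vecDegree A :=
  Finset.le_sup (f := fun i => (A i).natDegree) (Finset.mem_univ i)

theorem vecDegree_le {ι : Type*} [Fintype ι] {A : ι → ℝ[X]} {m : ℕ}
    (h : ∀ i, (A i).natDegree ≤ m) : vecDegree A ≤ m :=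
  Finset.sup_le fun i _ => h i

/-- Zero entries have `natDegree` `0`; a nonzero entry of `A` guarantees `0 < m`, which covers them.
-/
theorem vecDegree_lt {ι : Type*} [Fintype ι] {A : ι → ℝ[X]} {m : ℕ} (hA : A ≠ 0)
    (h : ∀ i, A i ≠ 0 → (A i).natDegree < m) : vecDegree A < m := by
  obtain ⟨j, hj⟩ := Function.ne_iff.1 hA
  rw [vecDegree, Finset.sup_lt_iff (by exact (Nat.zero_le _).trans_lt (h j hj))]
  intro i _
  by_cases hi : A i = 0
  · rw [hi, natDegree_zero]
    exact (Nat.zero_le _).trans_lt (h j hj)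
  · exact h i hi

theorem exists_leadVec_ne_zero {ι : Type*} [Fintype ι] {A : ι → ℝ[X]} (hA : A ≠ 0) :
    ∃ i, leadVec A i ≠ 0 := by
  by_contra! h
  refine (vecDegree_lt hA fun i hi => ?_).false
  refine lt_of_le_of_ne (natDegree_le_vecDegree A i) fun he => ?_
  have := h i
  rw [leadVec, ← he] at this
  exact hi (leadingCoeff_eq_zero.1 this)

/-! ### Existence of regular pairs -/

/-- Quasi-generators with coprime Plücker coordinates and linearly independent leading vectors. -/
structure IsRegularPair {n : ℕ} (M : Submodule ℝ[X] (Fin n → ℝ[X])) (P Q : Fin n → ℝ[X]) :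
    Prop where
  quasi : IsQuasiGenerators M P Q
  span_eq_top : Ideal.span (Set.range (wedge P Q)) = ⊤
  lead : ∃ i j, minor (leadVec P) (leadVec Q) i j ≠ 0

theorem ne_zero_of_wedge_left {n : ℕ} {P Q : Fin n → ℝ[X]} (h : wedge P Q ≠ 0) : P ≠ 0 := by
  rintro rfl
  exact h (by funext p; simp [wedge])

theorem ne_zero_of_wedge_right {n : ℕ} {P Q : Fin n → ℝ[X]} (h : wedge P Q ≠ 0) : Q ≠ 0 := by
  rintro rfl
  exact h (by funext p; simp [wedge])

/-- With proportional leading vectors, a monomial multiple of `P` cancels the top coefficient vector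
of `Q` without changing `P ∧ Q`. -/
theorem exists_reduction_of_lead {n : ℕ} {M : Submodule ℝ[X] (Fin n → ℝ[X])}
    {P Q : Fin n → ℝ[X]} (h : IsQuasiGenerators M P Q) (hle : vecDegree P ≤ vecDegree Q)
    (hl : ∀ i j, minor (leadVec P) (leadVec Q) i j = 0) :
    ∃ Q', IsQuasiGenerators M P Q' ∧ vecDegree Q' < vecDegree Q := by
  have hw := h.wedge_ne_zero
  obtain ⟨i₀, hi₀⟩ := exists_leadVec_ne_zero (ne_zero_of_wedge_left hw)
  set c := leadVec Q i₀ / leadVec P i₀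
  have hc : ∀ j, leadVec Q j = c * leadVec P j := by
    intro j
    have := hl i₀ j
    simp only [minor] at this
    simp only [c]
    field_simp
    linear_combination this
  set Q' : Fin n → ℝ[X] := Q - (C c * X ^ (vecDegree Q - vecDegree P)) • P with hQ'
  have hw' : wedge P Q' = wedge P Q := by
    funext p
    simp only [wedge, hQ', Pi.sub_apply, Pi.smul_apply, smul_eq_mul]
    ring
  have hmem : Q' ∈ M := M.sub_mem h.right_mem (M.smul_mem _ h.left_mem)
  refine ⟨Q', h.of_mem h.left_mem hmem (hw' ▸ hw),
    vecDegree_lt (ne_zero_of_wedge_right (hw' ▸ hw)) fun i hi => ?_⟩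
  have e : Q' i = Q i - C c * (P i * X ^ (vecDegree Q - vecDegree P)) := by
    simp only [hQ', Pi.sub_apply, Pi.smul_apply, smul_eq_mul]
    ring
  refine lt_of_le_of_ne ?_ fun he => hi (leadingCoeff_eq_zero.1 ?_)
  · rw [e]
    refine (natDegree_sub_le _ _).trans (max_le (natDegree_le_vecDegree Q i) ?_)
    refine (natDegree_C_mul_le _ _).trans (natDegree_mul_le.trans ?_)
    rw [natDegree_X_pow]
    have := natDegree_le_vecDegree P i
    omega
  · rw [leadingCoeff, he, e, coeff_sub, coeff_C_mul]
    conv_lhs => enter [2, 2, 2]; rw [← Nat.add_sub_cancel' hle]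
    rw [coeff_mul_X_pow]
    exact sub_eq_zero.2 (hc i)

/-- Modulo `π` the vectors are dependent, so some combination with coefficients of degree below `deg
π` is divisible by `π`; its quotient by `π` still lies in the module and has degree below the
maximum of the two degrees. -/
theorem exists_reduction_of_dvd {n : ℕ} {M : Submodule ℝ[X] (Fin n → ℝ[X])}
    {P Q : Fin n → ℝ[X]} (h : IsQuasiGenerators M P Q) {π : ℝ[X]} (hπ : Prime π)
    (hd : ∀ i j, π ∣ minor P Q i j) :
    (∃ P', IsQuasiGenerators M P' Q ∧ vecDegree P' < vecDegree P) ∨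
    ∃ Q', IsQuasiGenerators M P Q' ∧ (vecDegree Q' < vecDegree Q ∨ vecDegree Q' < vecDegree P) := by
  have hw := h.wedge_ne_zero
  have hπ1 : 0 < π.natDegree := Irreducible.natDegree_pos hπ.irreducible
  obtain ⟨i₁, j₁, hij⟩ := exists_minor_ne_zero hw
  have hM : ∀ {U : Fin n → ℝ[X]} {a b : ℝ[X]}, (∀ i, π * U i = a * P i + b * Q i) → U ∈ M := by
    intro U a b hU
    rw [← h.2]
    exact mem_quasiSpan_iff.2 ⟨π, a, b, hπ.ne_zero, hU⟩
  by_cases hP : ∀ i, π ∣ P i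
  · left
    choose P' hP' using hP
    have hw' : wedge P' Q ≠ 0 := by
      intro h0
      apply hw
      funext p
      have := congrFun h0 p
      simp only [wedge, Pi.zero_apply] at this ⊢
      rw [hP', hP']
      linear_combination π * this
    refine ⟨P', h.of_mem (hM (a := 1) (b := 0) fun i => by rw [← hP']; ring) h.right_mem hw',
      vecDegree_lt (ne_zero_of_wedge_left hw') fun i hi => ?_⟩
    have := natDegree_le_vecDegree P i
    rw [hP' i, natDegree_mul hπ.ne_zero hi] at this
    omega
  · right
    push Not at hP
    obtain ⟨i₀, hi₀⟩ := hP
    -- The coefficients are the remainders of `P i₀` and `Q i₀` rather than the entries themselves: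
    -- this bounds their degree and keeps the congruence modulo `π`.
    have hb : P i₀ % π ≠ 0 := fun h0 => hi₀ (EuclideanDomain.mod_eq_zero.1 h0)
    have hdiv : ∀ j, π ∣ (P i₀ % π) * Q j - (Q i₀ % π) * P j := by
      intro j
      have e1 := EuclideanDomain.div_add_mod (P i₀) π
      have e2 := EuclideanDomain.div_add_mod (Q i₀) π
      have : (P i₀ % π) * Q j - (Q i₀ % π) * P j =
          minor P Q i₀ j - π * (P i₀ / π * Q j - Q i₀ / π * P j) := by
        simp only [minor]
        linear_combination Q j * e1 - P j * e2
      rw [this]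
      exact dvd_sub (hd _ _) (dvd_mul_right _ _)
    choose Q' hQ' using hdiv
    have hw' : wedge P Q' ≠ 0 := by
      intro h0
      apply hw
      funext p
      have := congrFun h0 p
      simp only [wedge, Pi.zero_apply] at this ⊢
      refine (mul_eq_zero.1 (?_ : P i₀ % π * _ = 0)).resolve_left hb
      linear_combination π * this + P p.1.1 * hQ' p.1.2 - P p.1.2 * hQ' p.1.1
    refine ⟨Q', h.of_mem h.left_mem (hM (a := -(Q i₀ % π)) (b := P i₀ % π)
      fun i => by rw [← hQ']; ring) hw', ?_⟩
    rw [← lt_max_iff]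
    refine vecDegree_lt (ne_zero_of_wedge_right hw') fun i hi => ?_
    have h1 : (π * Q' i).natDegree = π.natDegree + (Q' i).natDegree :=
      natDegree_mul hπ.ne_zero hi
    have hm : ∀ f : ℝ[X], (f % π).natDegree < π.natDegree := fun f =>
      natDegree_mod_lt _ hπ1.ne'
    have h2 : ((P i₀ % π) * Q i - (Q i₀ % π) * P i).natDegree ≤
        max ((P i₀ % π).natDegree + (Q i).natDegree) ((Q i₀ % π).natDegree + (P i).natDegree) :=
      (natDegree_sub_le _ _).trans (max_le_max natDegree_mul_le natDegree_mul_le)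
    rw [hQ', h1] at h2
    have h3 := hm (P i₀)
    have h4 := hm (Q i₀)
    have h5 := natDegree_le_vecDegree P i
    have h6 := natDegree_le_vecDegree Q i
    omega

/-- Descent on `deg P + deg Q`: a failure of either regularity condition allows one of the two
reductions. Keeping `deg P ≤ deg Q` makes each of them lower the sum. -/
theorem exists_isRegularPair {n : ℕ} {M : Submodule ℝ[X] (Fin n → ℝ[X])} {A B : Fin n → ℝ[X]}
    (h : IsQuasiGenerators M A B) : ∃ P Q, IsRegularPair M P Q := by
  suffices H : ∀ N : ℕ, ∀ P Q, IsQuasiGenerators M P Q → vecDegree P ≤ vecDegree Q →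
      vecDegree P + vecDegree Q = N → ∃ P Q, IsRegularPair M P Q by
    rcases le_total (vecDegree A) (vecDegree B) with hle | hle
    · exact H _ A B h hle rfl
    · exact H _ B A h.swap hle rfl
  intro N
  induction N using Nat.strong_induction_on with
  | _ N ih =>
  intro P Q hPQ hle hN
  have step : ∀ {U V}, IsQuasiGenerators M U V → vecDegree U + vecDegree V < N →
      ∃ P Q, IsRegularPair M P Q := by
    intro U V hUV hlt
    rcases le_total (vecDegree U) (vecDegree V) with h1 | h1
    · exact ih _ hlt U V hUV h1 rfl
    · exact ih _ (by omega) V U hUV.swap h1 (add_comm _ _)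
  by_cases hl : ∀ i j, minor (leadVec P) (leadVec Q) i j = 0
  · obtain ⟨Q', h1, h2⟩ := exists_reduction_of_lead hPQ hle hl
    exact step h1 (by omega)
  by_cases hs : Ideal.span (Set.range (wedge P Q)) = ⊤
  · push Not at hl
    exact ⟨P, Q, hPQ, hs, hl⟩
  obtain ⟨m, hm, hsm⟩ := Ideal.exists_le_maximal _ hs
  have hw : ∀ p, wedge P Q p ∈ m := fun p => hsm (Ideal.subset_span ⟨p, rfl⟩)
  have hm0 : m ≠ ⊥ := by
    rintro rfl
    exact hPQ.wedge_ne_zero (funext fun p => (Submodule.mem_bot _).1 (hw p))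
  have hmp : m.IsPrime := hm.isPrime
  have hprime := Submodule.IsPrincipal.prime_generator_of_isPrime m hm0
  have hd : ∀ i j, Submodule.IsPrincipal.generator m ∣ minor P Q i j := by
    intro i j
    rw [← Submodule.IsPrincipal.mem_iff_generator_dvd]
    rcases lt_trichotomy i j with hij | hij | hij
    · exact hw ⟨(i, j), hij⟩
    · subst hij
      simp [minor]
    · rw [minor_swap]
      exact m.neg_mem (hw ⟨(j, i), hij⟩)
  rcases exists_reduction_of_dvd hPQ hprime hd with ⟨P', h1, h2⟩ | ⟨Q', h1, h2⟩
  · exact step h1 (by omega)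
  · exact step h1 (by omega)

theorem IsRegularPair.exists_minor_isUnit_sum {n : ℕ} {M : Submodule ℝ[X] (Fin n → ℝ[X])}
    {P Q : Fin n → ℝ[X]} (h : IsRegularPair M P Q) :
    ∃ κ : {p : Fin n × Fin n // p.1 < p.2} → ℝ[X], ∑ p, κ p * wedge P Q p = 1 := by
  have h1 : (1 : ℝ[X]) ∈ Ideal.span (Set.range (wedge P Q)) := by
    rw [h.span_eq_top]; trivial
  exact Ideal.mem_span_range_iff_exists_fun.1 h1

/-- By Cramer's rule `c` divides `a` and `b` times each Plücker coordinate of `P`, `Q`; a Bézout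
relation between these coordinates shows that `c` divides `a` and `b`. So a regular pair is a basis
over `ℝ[t]`. -/
theorem IsRegularPair.exists_comb {n : ℕ} {M : Submodule ℝ[X] (Fin n → ℝ[X])}
    {P Q U : Fin n → ℝ[X]} (h : IsRegularPair M P Q) (hU : U ∈ M) :
    ∃ a b : ℝ[X], ∀ i, U i = a * P i + b * Q i := by
  rw [← h.quasi.2] at hU
  obtain ⟨c, a, b, hc, hab⟩ := mem_quasiSpan_iff.1 hU
  obtain ⟨κ, hκ⟩ := h.exists_minor_isUnit_sum
  have ha : a = c * ∑ p, κ p * wedge U Q p := by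
    conv_lhs => rw [← mul_one a, ← hκ]
    rw [Finset.mul_sum, Finset.mul_sum]
    refine Finset.sum_congr rfl fun p _ => ?_
    simp only [wedge]
    linear_combination κ p * (Q p.1.1 * hab p.1.2 - Q p.1.2 * hab p.1.1)
  have hb : b = c * ∑ p, κ p * wedge P U p := by
    conv_lhs => rw [← mul_one b, ← hκ]
    rw [Finset.mul_sum, Finset.mul_sum]
    refine Finset.sum_congr rfl fun p _ => ?_
    simp only [wedge]
    linear_combination κ p * (P p.1.2 * hab p.1.1 - P p.1.1 * hab p.1.2)
  refine ⟨∑ p, κ p * wedge U Q p, ∑ p, κ p * wedge P U p, fun i => mul_left_cancel₀ hc ?_⟩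
  rw [hab, mul_add, ← mul_assoc, ← mul_assoc, ← ha, ← hb]

/-! ### Degrees of Plücker vectors and `μ`-bases -/

theorem natDegree_wedge_le {n : ℕ} (P Q : Fin n → ℝ[X]) (p) :
    (wedge P Q p).natDegree ≤ vecDegree P + vecDegree Q := by
  refine (natDegree_sub_le _ _).trans (max_le ?_ ?_) <;>
  refine natDegree_mul_le.trans (add_le_add ?_ ?_) <;>
  exact natDegree_le_vecDegree _ _

/-- This is why independence of the leading vectors means that `deg (P ∧ Q)` attains the bound `deg
P + deg Q`. -/
theorem coeff_wedge {n : ℕ} (P Q : Fin n → ℝ[X]) (p) :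
    (wedge P Q p).coeff (vecDegree P + vecDegree Q) =
      minor (leadVec P) (leadVec Q) p.1.1 p.1.2 := by
  have h := fun (i j : Fin n) => coeff_mul_add_eq_of_natDegree_le (natDegree_le_vecDegree P i)
    (natDegree_le_vecDegree Q j)
  rw [wedge, coeff_sub, h, h]
  rfl

theorem exists_minor_lt {n : ℕ} {u v : Fin n → ℝ} (h : ∃ i j, minor u v i j ≠ 0) :
    ∃ p : {p : Fin n × Fin n // p.1 < p.2}, minor u v p.1.1 p.1.2 ≠ 0 := by
  obtain ⟨i, j, hij⟩ := h
  rcases lt_trichotomy i j with hlt | hlt | hlt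
  · exact ⟨⟨(i, j), hlt⟩, hij⟩
  · subst hlt
    exact absurd (sub_self _) hij
  · refine ⟨⟨(j, i), hlt⟩, fun h0 => hij ?_⟩
    rw [minor_swap]
    exact neg_eq_zero.2 h0

theorem IsRegularPair.vecDegree_wedge {n : ℕ} {M : Submodule ℝ[X] (Fin n → ℝ[X])}
    {P Q : Fin n → ℝ[X]} (h : IsRegularPair M P Q) :
    vecDegree (wedge P Q) = vecDegree P + vecDegree Q := by
  refine le_antisymm (vecDegree_le (natDegree_wedge_le P Q)) ?_
  obtain ⟨p, hp⟩ := exists_minor_lt h.lead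
  rw [← coeff_wedge] at hp
  exact (le_natDegree_of_ne_zero hp).trans (natDegree_le_vecDegree _ p)

theorem vecDegree_mul {ι : Type*} [Fintype ι] {P : ι → ℝ[X]} {h : ℝ[X]} (hP : P ≠ 0)
    (hh : h ≠ 0) : vecDegree (fun i => h * P i) = h.natDegree + vecDegree P := by
  obtain ⟨i, hi⟩ := exists_leadVec_ne_zero hP
  have hi0 : P i ≠ 0 := fun h0 => hi (by simp [leadVec, h0])
  refine le_antisymm (vecDegree_le fun j => natDegree_mul_le.trans
    (Nat.add_le_add_left (natDegree_le_vecDegree P j) _)) ?_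
  refine le_trans ?_ (natDegree_le_vecDegree _ i)
  rw [natDegree_mul hh hi0]
  exact Nat.add_le_add_left (le_natDegree_of_ne_zero hi) _

/-- The Plücker coordinates of a pair in `M` are a multiple of those of a regular pair. -/
theorem IsRegularPair.exists_wedge_eq {n : ℕ} {M : Submodule ℝ[X] (Fin n → ℝ[X])}
    {P Q U V : Fin n → ℝ[X]} (h : IsRegularPair M P Q) (hUV : IsQuasiGenerators M U V) :
    ∃ g : ℝ[X], g ≠ 0 ∧ wedge U V = fun p => g * wedge P Q p := by
  obtain ⟨a, b, hU⟩ := h.exists_comb hUV.left_mem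
  obtain ⟨a', b', hV⟩ := h.exists_comb hUV.right_mem
  have e : wedge U V = fun p => (a * b' - b * a') * wedge P Q p := by
    funext p
    simp only [wedge, hU, hV]
    ring
  refine ⟨_, ?_, e⟩
  intro h0
  apply hUV.wedge_ne_zero
  rw [e, h0]
  funext p
  simp

theorem IsRegularPair.moduleDegree_eq {n : ℕ} {M : Submodule ℝ[X] (Fin n → ℝ[X])}
    {P Q : Fin n → ℝ[X]} (h : IsRegularPair M P Q) :
    moduleDegree M = vecDegree P + vecDegree Q := by
  apply le_antisymm
  · exact Nat.sInf_le ⟨P, Q, h.quasi, h.vecDegree_wedge⟩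
  · refine le_csInf ⟨_, P, Q, h.quasi, rfl⟩ ?_
    rintro m ⟨U, V, hUV, rfl⟩
    obtain ⟨g, hg, e⟩ := h.exists_wedge_eq hUV
    rw [e, vecDegree_mul h.quasi.wedge_ne_zero hg, h.vecDegree_wedge]
    omega

open scoped Pointwise in
theorem span_range_mul {ι : Type*} {P : ι → ℝ[X]} (hP : Ideal.span (Set.range P) = ⊤) (g : ℝ[X]) :
    Ideal.span (Set.range fun i => g * P i) = Ideal.span {g} := by
  have : (Set.range fun i => g * P i) = {g} * Set.range P := by
    ext x
    simp
  rw [this, ← Ideal.span_mul_span', hP, Ideal.mul_top]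

theorem IsRegularPair.natDegree_vecGcd {n : ℕ} {M : Submodule ℝ[X] (Fin n → ℝ[X])}
    {P Q U V : Fin n → ℝ[X]} (h : IsRegularPair M P Q) (hUV : IsQuasiGenerators M U V) :
    vecDegree (wedge U V) =
      (vecGcd (wedge U V)).natDegree + (vecDegree P + vecDegree Q) := by
  obtain ⟨g, hg, e⟩ := h.exists_wedge_eq hUV
  have hgcd : Associated (vecGcd (wedge U V)) g := by
    rw [← Ideal.span_singleton_eq_span_singleton, vecGcd, Ideal.span_singleton_generator, e,
      span_range_mul h.span_eq_top]
  rw [natDegree_eq_of_degree_eq (degree_eq_degree_of_associated hgcd), e,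
    vecDegree_mul h.quasi.wedge_ne_zero hg, h.vecDegree_wedge]

/-- Compared with a regular pair `P`, `Q`, one has `U ∧ V = g (P ∧ Q)`, hence `deg g + deg M ≤ deg U
+ deg V = deg M`. So `g` is constant and there is no cancellation in top degree. -/
theorem IsMuBasis.isRegularPair {n : ℕ} {M : Submodule ℝ[X] (Fin n → ℝ[X])}
    {U V : Fin n → ℝ[X]} (hUV : IsMuBasis M U V) : IsRegularPair M U V := by
  obtain ⟨P, Q, h⟩ := exists_isRegularPair hUV.1
  obtain ⟨g, hg, e⟩ := h.exists_wedge_eq hUV.1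
  have hdeg := hUV.2
  rw [h.moduleDegree_eq] at hdeg
  have h1 : vecDegree (wedge U V) ≤ vecDegree U + vecDegree V :=
    vecDegree_le (natDegree_wedge_le U V)
  have h2 : vecDegree (wedge U V) = g.natDegree + (vecDegree P + vecDegree Q) := by
    rw [e, vecDegree_mul h.quasi.wedge_ne_zero hg, h.vecDegree_wedge]
  refine ⟨hUV.1, ?_, ?_⟩
  · rw [e, span_range_mul h.span_eq_top, Ideal.span_singleton_eq_top]
    exact isUnit_iff_degree_eq_zero.2 (by
      rw [degree_eq_natDegree hg]
      exact_mod_cast (show g.natDegree = 0 by omega))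
  · obtain ⟨p, hp⟩ := exists_leadVec_ne_zero hUV.1.wedge_ne_zero
    refine ⟨p.1.1, p.1.2, ?_⟩
    rw [← coeff_wedge, show vecDegree U + vecDegree V = vecDegree (wedge U V) by omega]
    exact hp

/-! ### Order of vanishing of a resultant along a pencil -/

/-- `N` is only an upper bound for `deg u`: as the degree of `f` is exact, a drop in the degree of
`u` does no harm. -/
theorem resultant_ne_zero_of_eval_ne_zero {K : Type*} [Field K] [IsAlgClosed K] {f u : K[X]}
    {N : ℕ} (hf : f ≠ 0) (hu : u.natDegree ≤ N) (h : ∀ t, f.eval t = 0 → u.eval t ≠ 0) :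
    resultant f u f.natDegree N ≠ 0 := by
  rw [resultant_eq_prod_eval f u N hu (IsAlgClosed.splits f)]
  refine mul_ne_zero (pow_ne_zero _ (leadingCoeff_ne_zero.2 hf)) ?_
  refine Multiset.prod_ne_zero fun h0 => ?_
  revert h0
  rw [Multiset.mem_map]
  rintro ⟨t, ht, h0⟩
  exact h t ((mem_roots hf).1 ht) h0

theorem natDegree_map_C_add {K : Type*} [Field K] {f fv : K[X]} {p : ℕ} (hf : f.natDegree = p)
    (hf0 : f ≠ 0) (hfv : fv.natDegree ≤ p) :
    (f.map (C : K →+* K[X]) + C X * fv.map C).natDegree = p := by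
  refine natDegree_eq_of_le_of_coeff_ne_zero ?_ ?_
  · refine (natDegree_add_le _ _).trans (max_le (natDegree_map_le.trans hf.le) ?_)
    exact (natDegree_C_mul_le _ _).trans (natDegree_map_le.trans hfv)
  · intro h0
    have := congrArg (eval 0) h0
    rw [coeff_add, coeff_C_mul, coeff_map, coeff_map] at this
    simp [← hf] at this
    exact hf0 this

/-- The order of vanishing of the resultant along a pencil through two polynomials whose common
roots become simple roots of the Jacobian is the number of these common roots. -/
theorem exists_resultant_pencil_eq {K : Type*} [Field K] [IsAlgClosed K] {f g fv gv : K[X]}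
    {p q : ℕ} (hf : f.natDegree = p) (hg : g.natDegree = q) (hf0 : f ≠ 0) (hg0 : g ≠ 0)
    (hfv : fv.natDegree ≤ p) (hgv : gv.natDegree ≤ q) (Z : Finset K)
    (hZ : ∀ t, t ∈ Z ↔ f.eval t = 0 ∧ g.eval t = 0)
    (hw : ∀ t ∈ Z, (derivative (f * gv - fv * g)).eval t ≠ 0)
    (hv : ∀ t, f.eval t = 0 → fv.eval t ≠ 0) :
    ∃ (c : K) (T : K[X]), c ≠ 0 ∧ T.eval 0 ≠ 0 ∧
      C c * resultant (f.map (C : K →+* K[X]) + C X * fv.map C) (g.map C + C X * gv.map C) p q =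
        X ^ Z.card * T := by
  classical
  -- Write `f = h f₁`, `g = h g₁`, let `s` be the pencil parameter and `f_s`, `g_s` its members.
  -- With `u = f₁ gv - g₁ fv` one has `f₁ g_s = s u + f_s g₁` and `f_s = s fv + f₁ h`. Hence
  -- `Res(f_s, f₁) Res(f_s, g_s) = s ^ p Res(f_s, u)` and `Res(f_s, f₁) = s ^ deg f₁ Res(fv, f₁)`;
  -- the powers of `s` differ by `p - deg f₁ = Z.card`.
  set h : K[X] := ∏ t ∈ Z, (X - C t) with hh
  have hhm : h.Monic := monic_prod_of_monic _ _ fun t _ => monic_X_sub_C t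
  have hhd : h.natDegree = Z.card := by
    rw [hh, natDegree_prod_of_monic _ _ fun t _ => monic_X_sub_C t]
    simp
  have hroot : ∀ t, h.eval t = 0 ↔ t ∈ Z := by
    intro t
    rw [hh, eval_prod, Finset.prod_eq_zero_iff]
    simp [sub_eq_zero]
  have hdvd : ∀ {u : K[X]}, (∀ t ∈ Z, u.eval t = 0) → h ∣ u := by
    intro u hu
    refine Finset.prod_dvd_of_coprime (fun a _ b _ hab => ?_) fun t ht => ?_
    · exact pairwise_coprime_X_sub_C Function.injective_id hab
    · exact dvd_iff_isRoot.2 (hu t ht)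
  obtain ⟨f₁, hf₁⟩ := hdvd fun t ht => ((hZ t).1 ht).1
  obtain ⟨g₁, hg₁⟩ := hdvd fun t ht => ((hZ t).1 ht).2
  have hf₁0 : f₁ ≠ 0 := by rintro rfl; exact hf0 (by rw [hf₁, mul_zero])
  have hg₁0 : g₁ ≠ 0 := by rintro rfl; exact hg0 (by rw [hg₁, mul_zero])
  have hdf : Z.card + f₁.natDegree = p := by
    rw [← hf, hf₁, natDegree_mul hhm.ne_zero hf₁0, hhd]
  have hdg : Z.card + g₁.natDegree = q := by
    rw [← hg, hg₁, natDegree_mul hhm.ne_zero hg₁0, hhd]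
  set u := f₁ * gv - g₁ * fv with hu
  have hud : u.natDegree ≤ f₁.natDegree + q := by
    refine (natDegree_sub_le _ _).trans (max_le ?_ ?_)
    · exact natDegree_mul_le.trans (by omega)
    · exact natDegree_mul_le.trans (by omega)
  -- At common roots this is the simplicity of the root of `f gv - fv g = h u`; at the other roots
  -- of `f` only the term `g₁ fv` survives.
  have hne : ∀ t, f.eval t = 0 → u.eval t ≠ 0 := by
    intro t ht
    by_cases htZ : t ∈ Z
    · have h1 := hw t htZ
      have h2 : f * gv - fv * g = h * u := by
        rw [hu, hf₁, hg₁]; ring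
      rw [h2, derivative_mul, eval_add, eval_mul, eval_mul, (hroot t).2 htZ, zero_mul,
        add_zero] at h1
      exact right_ne_zero_of_mul h1
    · have hht : h.eval t ≠ 0 := fun h0 => htZ ((hroot t).1 h0)
      have h1 : f₁.eval t = 0 := by
        rw [hf₁, eval_mul] at ht
        exact (mul_eq_zero.1 ht).resolve_left hht
      have h2 : g₁.eval t ≠ 0 := by
        intro h0
        exact htZ ((hZ t).2 ⟨ht, by rw [hg₁, eval_mul, h0, mul_zero]⟩)
      rw [hu, eval_sub, eval_mul, eval_mul, h1, zero_mul, zero_sub]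
      exact neg_ne_zero.2 (mul_ne_zero h2 (hv t ht))
  set φ : K →+* K[X] := C
  have hCinj : Function.Injective φ := C_injective
  set fs := f.map φ + C X * fv.map φ with hfs
  set gs := g.map φ + C X * gv.map φ with hgs
  have hfsd : fs.natDegree = p := natDegree_map_C_add hf hf0 hfv
  have hgsd : gs.natDegree = q := natDegree_map_C_add hg hg0 hgv
  have hf₁d : (f₁.map φ).natDegree = f₁.natDegree := natDegree_map_eq_of_injective hCinj _
  have hg₁d : (g₁.map φ).natDegree = g₁.natDegree := natDegree_map_eq_of_injective hCinj _
  have hhd' : (h.map φ).natDegree = Z.card := by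
    rw [natDegree_map_eq_of_injective hCinj, hhd]
  -- the key identity between resultants
  have e1 : resultant fs (f₁.map φ * gs) p (f₁.natDegree + q) =
      resultant fs (f₁.map φ) p f₁.natDegree * resultant fs gs p q := by
    have := resultant_mul_right fs (f₁.map φ) gs p hfsd.le
    rwa [hf₁d, hgsd] at this
  have e2 : f₁.map φ * gs = C X * u.map φ + fs * g₁.map φ := by
    rw [hfs, hgs, hu, hf₁, hg₁]
    simp only [Polynomial.map_mul, Polynomial.map_sub]
    ring
  have e3 : resultant fs (f₁.map φ * gs) p (f₁.natDegree + q) =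
      X ^ p * resultant fs (u.map φ) p (f₁.natDegree + q) := by
    rw [e2, resultant_add_mul_right _ _ _ _ _ (by rw [hg₁d]; omega) hfsd.le,
      resultant_C_mul_right]
  have e4 : resultant fs (f₁.map φ) p f₁.natDegree =
      X ^ f₁.natDegree * C (resultant fv f₁ p f₁.natDegree) := by
    have : fs = C X * fv.map φ + f₁.map φ * h.map φ := by
      rw [hfs, hf₁, Polynomial.map_mul]; ring
    rw [this, resultant_add_mul_left _ _ _ _ _ (by rw [hhd']; omega) hf₁d.le,
      resultant_C_mul_left, resultant_map_map]
  refine ⟨resultant fv f₁ p f₁.natDegree, resultant fs (u.map φ) p (f₁.natDegree + q), ?_, ?_, ?_⟩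
  · rw [resultant_comm]
    refine mul_ne_zero (pow_ne_zero _ (neg_ne_zero.2 one_ne_zero)) ?_
    exact resultant_ne_zero_of_eval_ne_zero hf₁0 hfv fun t ht =>
      hv t (by rw [hf₁, eval_mul, ht, mul_zero])
  · have : (resultant fs (u.map φ) p (f₁.natDegree + q)).eval 0 =
        resultant f u p (f₁.natDegree + q) := by
      rw [← coe_evalRingHom, ← resultant_map_map]
      congr 1
      · rw [hfs, Polynomial.map_add, Polynomial.map_mul, map_C, Polynomial.map_map,
          Polynomial.map_map]
        have : (evalRingHom (0 : K)).comp φ = RingHom.id K := by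
          ext x; simp [φ]
        rw [this]
        simp
      · rw [Polynomial.map_map]
        have : (evalRingHom (0 : K)).comp φ = RingHom.id K := by
          ext x; simp [φ]
        rw [this, Polynomial.map_id]
    rw [this, ← hf]
    exact resultant_ne_zero_of_eval_ne_zero hf0 hud hne
  · have hX : (X : K[X]) ^ f₁.natDegree ≠ 0 := pow_ne_zero _ X_ne_zero
    apply mul_left_cancel₀ hX
    rw [← mul_assoc, ← e4, ← e1, e3, ← mul_assoc, ← pow_add]
    congr 2
    omega

theorem eq_of_X_pow_mul_eq {K : Type*} [Field K] {m k : ℕ} {a b : K[X]} (ha : a.eval 0 ≠ 0)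
    (hb : b.eval 0 ≠ 0) (h : X ^ m * a = X ^ k * b) : m = k := by
  have key : ∀ {m k : ℕ} {a b : K[X]}, a.eval 0 ≠ 0 → X ^ m * a = X ^ k * b → k ≤ m := by
    intro m k a b ha h
    by_contra! hlt
    obtain ⟨d, rfl⟩ := Nat.exists_eq_add_of_lt hlt
    have : a = X ^ (d + 1) * b := by
      apply mul_left_cancel₀ (pow_ne_zero m (X_ne_zero (R := K)))
      rw [h]; ring
    exact ha (by rw [this]; simp)
  exact le_antisymm (key hb h.symm) (key ha h)

/-! ### The resultant of the two linear forms -/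

/-- The values at `τ` of the entries of a polynomial vector. -/
def evalVec {ι B : Type*} [CommRing B] [Algebra ℝ B] (τ : B) (U : ι → ℝ[X]) : ι → B :=
  fun i => aeval τ (U i)

/-- The polynomial `P · x` for a constant vector `x`. -/
def dotPoly {n : ℕ} {B : Type*} [CommRing B] [Algebra ℝ B] (P : Fin n → ℝ[X]) (x : Fin n → B) :
    B[X] :=
  ∑ i, (P i).map (algebraMap ℝ B) * C (x i)

section
variable {n : ℕ} {B : Type*} [CommRing B] [Algebra ℝ B]

theorem eval_dotPoly (P : Fin n → ℝ[X]) (x : Fin n → B) (t : B) :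
    (dotPoly P x).eval t = evalVec t P ⬝ᵥ x := by
  simp [dotPoly, dotProduct, eval_finsetSum, evalVec, eval_map_algebraMap]

theorem derivative_dotPoly (P : Fin n → ℝ[X]) (x : Fin n → B) :
    derivative (dotPoly P x) = dotPoly (vecDeriv P) x := by
  simp [dotPoly, derivative_map, vecDeriv]

theorem dotPoly_add_smul (P : Fin n → ℝ[X]) (x v : Fin n → B) (s : B) :
    dotPoly P (x + s • v) = dotPoly P x + C s * dotPoly P v := by
  simp only [dotPoly, Finset.mul_sum, ← Finset.sum_add_distrib]
  refine Finset.sum_congr rfl fun i _ => ?_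
  simp only [Pi.add_apply, Pi.smul_apply, smul_eq_mul, C_add, C_mul]
  ring

theorem coeff_dotPoly (P : Fin n → ℝ[X]) (x : Fin n → B) :
    (dotPoly P x).coeff (vecDegree P) = (fun i => algebraMap ℝ B (leadVec P i)) ⬝ᵥ x := by
  simp [dotPoly, dotProduct, leadVec]

theorem natDegree_dotPoly_le (P : Fin n → ℝ[X]) (x : Fin n → B) :
    (dotPoly P x).natDegree ≤ vecDegree P := by
  refine natDegree_sum_le_of_forall_le _ _ fun i _ => ?_
  exact (natDegree_mul_C_le _ _).trans (natDegree_map_le.trans (natDegree_le_vecDegree P i))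

theorem map_dotPoly {B' : Type*} [CommRing B'] [Algebra ℝ B'] (φ : B →ₐ[ℝ] B') (P : Fin n → ℝ[X])
    (x : Fin n → B) : (dotPoly P x).map (φ : B →+* B') = dotPoly P fun i => φ (x i) := by
  simp [dotPoly, Polynomial.map_sum, Polynomial.map_map]

end

theorem linForm_eq_dotPoly {n : ℕ} (P : Fin n → ℝ[X]) :
    linForm P = dotPoly P (MvPolynomial.X : Fin n → MvPolynomial (Fin n) ℝ) := rfl

theorem map_aeval_linForm {n : ℕ} {B : Type*} [CommRing B] [Algebra ℝ B] (P : Fin n → ℝ[X])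
    (x : Fin n → B) :
    (linForm P).map (MvPolynomial.aeval x : MvPolynomial (Fin n) ℝ →ₐ[ℝ] B) = dotPoly P x := by
  rw [linForm_eq_dotPoly, map_dotPoly]
  simp

theorem natDegree_linForm {n : ℕ} {P : Fin n → ℝ[X]} (hP : P ≠ 0) :
    (linForm P).natDegree = vecDegree P := by
  refine natDegree_eq_of_le_of_coeff_ne_zero (natDegree_dotPoly_le P _) fun h0 => ?_
  obtain ⟨i, hi⟩ := exists_leadVec_ne_zero hP
  have h1 := congrArg (MvPolynomial.aeval (Pi.single i 1 : Fin n → ℝ)) h0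
  rw [linForm_eq_dotPoly, coeff_dotPoly] at h1
  apply hi
  simpa [dotProduct, Pi.single_apply] using h1

/-- The formal degrees are kept fixed because the specialized polynomials may have smaller degree.
-/
theorem aeval_resultant_linForm {n : ℕ} {P Q : Fin n → ℝ[X]} (hP : P ≠ 0) (hQ : Q ≠ 0)
    {B : Type*} [CommRing B] [Algebra ℝ B] (x : Fin n → B) :
    MvPolynomial.aeval x (resultant (linForm P) (linForm Q)) =
      resultant (dotPoly P x) (dotPoly Q x) (vecDegree P) (vecDegree Q) := by
  rw [natDegree_linForm hP, natDegree_linForm hQ, ← map_aeval_linForm P, ← map_aeval_linForm Q,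
    resultant_map_map]
  rfl

theorem isHomogeneous_coeff_linForm {n : ℕ} (P : Fin n → ℝ[X]) (m : ℕ) :
    ((linForm P).coeff m).IsHomogeneous 1 := by
  rw [linForm, finsetSum_coeff]
  refine MvPolynomial.IsHomogeneous.sum _ _ _ fun i _ => ?_
  rw [coeff_mul_C, coeff_map]
  exact (MvPolynomial.isHomogeneous_X _ i).C_mul _

/-- Every entry of the Sylvester matrix is a linear form or zero, and the matrix has size `deg P +
deg Q`. -/
theorem isHomogeneous_resultant_linForm {n : ℕ} {P Q : Fin n → ℝ[X]} (hP : P ≠ 0) (hQ : Q ≠ 0) :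
    (resultant (linForm P) (linForm Q)).IsHomogeneous (vecDegree P + vecDegree Q) := by
  rw [natDegree_linForm hP, natDegree_linForm hQ, resultant, Matrix.det_apply]
  refine MvPolynomial.IsHomogeneous.sum _ _ _ fun σ _ => ?_
  have h1 : (∏ i, sylvester (linForm P) (linForm Q) (vecDegree P) (vecDegree Q) (σ i) i)
      |>.IsHomogeneous (∑ _i : Fin (vecDegree P + vecDegree Q), 1) := by
    refine MvPolynomial.IsHomogeneous.prod _ _ _ fun i _ => ?_
    rw [sylvester, Matrix.of_apply]
    refine Fin.addCases (fun j => ?_) (fun j => ?_) i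
    · rw [Fin.addCases_left]
      split_ifs
      · exact isHomogeneous_coeff_linForm _ _
      · exact MvPolynomial.isHomogeneous_zero _ _ _
    · rw [Fin.addCases_right]
      split_ifs
      · exact isHomogeneous_coeff_linForm _ _
      · exact MvPolynomial.isHomogeneous_zero _ _ _
  simp only [Finset.sum_const, Finset.card_univ, Fintype.card_fin, smul_eq_mul, mul_one] at h1
  rw [Units.smul_def]
  exact zsmul_mem (show _ ∈ MvPolynomial.homogeneousSubmodule (Fin n) ℝ _ from h1) _

/-- If a formal resultant over an algebraically closed field vanishes, there is a common root or both
leading coefficients vanish. -/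
theorem exists_root_of_resultant_eq_zero {K : Type*} [Field K] [IsAlgClosed K] {f g : K[X]}
    {p q : ℕ} (hf : f.natDegree ≤ p) (hg : g.natDegree ≤ q) (h : resultant f g p q = 0) :
    (∃ t, f.eval t = 0 ∧ g.eval t = 0) ∨ (f.coeff p = 0 ∧ g.coeff q = 0) := by
  by_contra! hcon
  obtain ⟨h1, h2⟩ := hcon
  have key : ∀ {f g : K[X]} {p q : ℕ}, f.natDegree ≤ p → g.natDegree ≤ q → f.coeff p ≠ 0 →
      (∀ t, f.eval t = 0 → g.eval t ≠ 0) → resultant f g p q ≠ 0 := by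
    intro f g p q hf hg hp h
    have hd : f.natDegree = p := natDegree_eq_of_le_of_coeff_ne_zero hf hp
    rw [← hd]
    exact resultant_ne_zero_of_eval_ne_zero (fun h0 => hp (by rw [h0, coeff_zero])) hg h
  by_cases hp : f.coeff p = 0
  · rw [resultant_comm] at h
    exact key hg hf (h2 hp) (fun t ht h0 => h1 t h0 ht)
      ((mul_eq_zero.1 h).resolve_left (pow_ne_zero _ (neg_ne_zero.2 one_ne_zero)))
  · exact key hf hg hp h1 h

theorem resultant_eq_zero_of_root {K : Type*} [Field K] {f g : K[X]} {p q : ℕ}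
    (hf : f.natDegree ≤ p) (hg : g.natDegree ≤ q) (hpq : p + q ≠ 0) {t : K} (h1 : f.eval t = 0)
    (h2 : g.eval t = 0) : resultant f g p q = 0 := by
  obtain ⟨a, b, -, -, hab⟩ := exists_mul_add_mul_eq_C_resultant f g hf hg (by omega)
  have := congrArg (eval t) hab
  simpa [h1, h2] using this.symm

/-! ### Generic choices -/

theorem exists_forall_eval_ne_zero {K σ : Type*} [Field K] [Infinite K]
    (S : Finset (MvPolynomial σ K)) (h : ∀ f ∈ S, f ≠ 0) :
    ∃ v : σ → K, ∀ f ∈ S, MvPolynomial.eval v f ≠ 0 := by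
  by_contra! hcon
  refine Finset.prod_ne_zero_iff.2 h (MvPolynomial.funext fun v => ?_)
  obtain ⟨f, hf, h0⟩ := hcon v
  rw [map_prod, map_zero]
  exact Finset.prod_eq_zero hf h0

/-- The linear form `x ↦ u · x` as a polynomial. -/
def linPoly {ι R : Type*} [Fintype ι] [CommRing R] (u : ι → R) : MvPolynomial ι R :=
  ∑ i, MvPolynomial.C (u i) * MvPolynomial.X i

theorem eval_linPoly {ι R : Type*} [Fintype ι] [CommRing R] (u v : ι → R) :
    MvPolynomial.eval v (linPoly u) = u ⬝ᵥ v := by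
  simp [linPoly, dotProduct]

theorem linPoly_ne_zero {ι R : Type*} [Fintype ι] [CommRing R] {u : ι → R} (hu : u ≠ 0) :
    linPoly u ≠ 0 := by
  classical
  intro h0
  apply hu
  funext i
  have := congrArg (MvPolynomial.eval (Pi.single i 1)) h0
  rw [eval_linPoly] at this
  simpa using this

theorem exists_forall_dotProduct_ne_zero {K : Type*} [Field K] [Infinite K] {n : ℕ}
    (S : Finset (Fin n → K)) (h : ∀ u ∈ S, u ≠ 0) : ∃ v : Fin n → K, ∀ u ∈ S, u ⬝ᵥ v ≠ 0 := by
  classical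
  obtain ⟨v, hv⟩ := exists_forall_eval_ne_zero (S.image linPoly) (by
    intro f hf
    obtain ⟨u, hu, rfl⟩ := Finset.mem_image.1 hf
    exact linPoly_ne_zero (h u hu))
  exact ⟨v, fun u hu => eval_linPoly u v ▸ hv _ (Finset.mem_image_of_mem _ hu)⟩

theorem evalVec_algHom {ι B B' : Type*} [CommRing B] [Algebra ℝ B] [CommRing B'] [Algebra ℝ B']
    (φ : B →ₐ[ℝ] B') (τ : B) (U : ι → ℝ[X]) :
    evalVec (φ τ) U = fun i => φ (evalVec τ U i) := by
  funext i
  exact aeval_algHom_apply φ τ (U i)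

theorem evalVec_dotProduct {n : ℕ} {B : Type*} [CommRing B] [Algebra ℝ B] (τ : B)
    (U V : Fin n → ℝ[X]) : evalVec τ U ⬝ᵥ evalVec τ V = aeval τ (U ⬝ᵥ V) := by
  simp [dotProduct, evalVec, map_sum]

theorem minor_evalVec {ι : Type*} {B : Type*} [CommRing B] [Algebra ℝ B] (τ : B)
    (U V : ι → ℝ[X]) (i j : ι) :
    minor (evalVec τ U) (evalVec τ V) i j = aeval τ (minor U V i j) := by
  simp [minor, evalVec]

theorem IsRegularPair.exists_aeval_minor_ne_zero {n : ℕ} {M : Submodule ℝ[X] (Fin n → ℝ[X])}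
    {P Q : Fin n → ℝ[X]} (h : IsRegularPair M P Q) {K : Type*} [Field K] [Algebra ℝ K] (t : K) :
    ∃ i j, aeval t (minor P Q i j) ≠ 0 := by
  by_contra! hcon
  obtain ⟨κ, hκ⟩ := h.exists_minor_isUnit_sum
  have := congrArg (aeval t) hκ
  rw [map_sum, map_one] at this
  refine zero_ne_one (this.symm.trans ?_).symm
  refine Finset.sum_eq_zero fun p _ => ?_
  rw [map_mul, show wedge P Q p = minor P Q p.1.1 p.1.2 from rfl, hcon, mul_zero]

theorem IsRegularPair.left_ne_zero {n : ℕ} {M : Submodule ℝ[X] (Fin n → ℝ[X])}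
    {P Q : Fin n → ℝ[X]} (h : IsRegularPair M P Q) : P ≠ 0 :=
  ne_zero_of_wedge_left h.quasi.wedge_ne_zero

theorem IsRegularPair.right_ne_zero {n : ℕ} {M : Submodule ℝ[X] (Fin n → ℝ[X])}
    {P Q : Fin n → ℝ[X]} (h : IsRegularPair M P Q) : Q ≠ 0 :=
  ne_zero_of_wedge_right h.quasi.wedge_ne_zero

theorem IsRegularPair.evalVec_left_ne_zero {n : ℕ} {M : Submodule ℝ[X] (Fin n → ℝ[X])}
    {P Q : Fin n → ℝ[X]} (h : IsRegularPair M P Q) {K : Type*} [Field K] [Algebra ℝ K] (t : K) :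
    evalVec t P ≠ 0 := by
  intro h0
  obtain ⟨i, j, hij⟩ := h.exists_aeval_minor_ne_zero t
  rw [← minor_evalVec, h0] at hij
  simp [minor] at hij

theorem map_leadVec_ne_zero {ι : Type*} [Fintype ι] {A : ι → ℝ[X]} (hA : A ≠ 0) {K : Type*}
    [Field K] [Algebra ℝ K] : (fun i => algebraMap ℝ K (leadVec A i)) ≠ 0 := by
  obtain ⟨i, hi⟩ := exists_leadVec_ne_zero hA
  intro h0
  have := congrFun h0 i
  simp at this
  exact hi this

/-- On a suitable line `x + s v`, a common root `t` of the two specialized forms is a root of `w =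
(P·x)(Q·v) - (P·v)(Q·x)`, which does not depend on `s`. There are finitely many such `t`, and each
allows at most one `s`; one more value of `s` is excluded to keep the leading coefficient. -/
theorem IsRegularPair.resultant_ne_zero {n : ℕ} {M : Submodule ℝ[X] (Fin n → ℝ[X])}
    {P Q : Fin n → ℝ[X]} (h : IsRegularPair M P Q) :
    resultant (linForm P) (linForm Q) ≠ 0 := by
  classical
  obtain ⟨x, hx⟩ := exists_forall_dotProduct_ne_zero
    {fun i => algebraMap ℝ ℂ (leadVec P i)} (by
      intro u hu
      rw [Finset.mem_singleton.1 hu]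
      exact map_leadVec_ne_zero h.left_ne_zero)
  replace hx := hx _ (Finset.mem_singleton_self _)
  set f := dotPoly P x with hf
  set g := dotPoly Q x with hg
  rw [← coeff_dotPoly, ← hf] at hx
  have hf0 : f ≠ 0 := fun h0 => hx (by rw [h0, coeff_zero])
  let φ : ℝ[X] → ℂ[X] := Polynomial.map (algebraMap ℝ ℂ)
  have hW : ∃ i, f * φ (Q i) - φ (P i) * g ≠ 0 := by
    by_contra! h0
    obtain ⟨i, j, hij⟩ := h.exists_aeval_minor_ne_zero (0 : ℂ)
    have h1 : f * φ (minor P Q i j) = 0 := by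
      simp only [φ, minor, Polynomial.map_sub, Polynomial.map_mul]
      linear_combination φ (P i) * h0 j - φ (P j) * h0 i
    have h2 := (mul_eq_zero.1 h1).resolve_left hf0
    apply hij
    rw [← eval_map_algebraMap]
    exact (congrArg (eval 0) h2).trans eval_zero
  obtain ⟨i₀, hi₀⟩ := hW
  set m := (f * φ (Q i₀) - φ (P i₀) * g).natDegree
  set W : Fin n → ℂ := fun i => (f * φ (Q i) - φ (P i) * g).coeff m
  have hW0 : W ≠ 0 := by
    intro h0
    exact leadingCoeff_ne_zero.2 hi₀ (congrFun h0 i₀)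
  obtain ⟨v, hv⟩ := exists_forall_dotProduct_ne_zero
    (insert W (f.roots.toFinset.image fun t => evalVec t P)) (by
      intro u hu
      rcases Finset.mem_insert.1 hu with rfl | hu
      · exact hW0
      · obtain ⟨t, -, rfl⟩ := Finset.mem_image.1 hu
        exact h.evalVec_left_ne_zero t)
  have hv1 : ∀ t, f.eval t = 0 → (dotPoly P v).eval t ≠ 0 := by
    intro t ht
    rw [eval_dotPoly]
    exact hv _ (Finset.mem_insert_of_mem (Finset.mem_image_of_mem _
      (Multiset.mem_toFinset.2 ((mem_roots hf0).2 ht))))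
  set w := f * dotPoly Q v - dotPoly P v * g with hw
  have hw0 : w ≠ 0 := by
    intro h0
    apply hv W (Finset.mem_insert_self _ _)
    have h1 : w = ∑ i, (f * φ (Q i) - φ (P i) * g) * C (v i) := by
      simp only [hw, dotPoly, sub_mul, Finset.sum_sub_distrib, Finset.mul_sum, Finset.sum_mul]
      refine congrArg₂ _ (Finset.sum_congr rfl fun i _ => ?_) (Finset.sum_congr rfl fun i _ => ?_)
        <;> ring
    have h2 := congrArg (fun p => coeff p m) (h1.symm.trans h0)
    simpa [finsetSum_coeff, dotProduct, W] using h2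
  set bad : Finset ℂ := {-(f.coeff (vecDegree P) / (dotPoly P v).coeff (vecDegree P))} ∪
    (w.roots.toFinset.image (fun t => -(f.eval t / (dotPoly P v).eval t)) ∪
     w.roots.toFinset.image (fun t => -(g.eval t / (dotPoly Q v).eval t)))
  obtain ⟨s, hs⟩ := Infinite.exists_notMem_finset bad
  have hsol : ∀ a b : ℂ, b ≠ 0 → a + s * b = 0 → s = -(a / b) := by
    intro a b hb hab
    field_simp
    linear_combination hab
  intro hR
  have hRs := aeval_resultant_linForm h.left_ne_zero h.right_ne_zero (x + s • v)
  rw [hR, map_zero] at hRs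
  rcases exists_root_of_resultant_eq_zero (natDegree_dotPoly_le _ _) (natDegree_dotPoly_le _ _)
    hRs.symm with ⟨t, h1, h2⟩ | ⟨h1, -⟩
  · rw [dotPoly_add_smul, eval_add, eval_mul, eval_C] at h1 h2
    have hwt : w.eval t = 0 := by
      rw [hw, eval_sub, eval_mul, eval_mul]
      linear_combination (dotPoly Q v).eval t * h1 - (dotPoly P v).eval t * h2
    have hmem : t ∈ w.roots.toFinset := Multiset.mem_toFinset.2 ((mem_roots hw0).2 hwt)
    by_cases hP : (dotPoly P v).eval t = 0
    · rw [hP, mul_zero, add_zero] at h1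
      exact hv1 t h1 hP
    · exact hs (Finset.mem_union_right _ (Finset.mem_union_left _
        (Finset.mem_image.2 ⟨t, hmem, (hsol _ _ hP h1).symm⟩)))
  · rw [dotPoly_add_smul, coeff_add, coeff_C_mul] at h1
    by_cases hP : (dotPoly P v).coeff (vecDegree P) = 0
    · rw [hP, mul_zero, add_zero] at h1
      exact hx h1
    · exact hs (Finset.mem_union_left _ (Finset.mem_singleton.2 (hsol _ _ hP h1)))

/-! ### Polynomials vanishing on the fibres -/

/-- The kernel of `U(t)`, `V(t)` is parametrized by `δ y - (U · y) α - (V · y) β`. -/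
structure IsPairFrame {n : ℕ} (U V α β : Fin n → ℝ[X]) (δ : ℝ[X]) : Prop where
  aa : U ⬝ᵥ α = δ
  ab : U ⬝ᵥ β = 0
  ba : V ⬝ᵥ α = 0
  bb : V ⬝ᵥ β = δ

theorem isPairFrame_minor {n : ℕ} (U V : Fin n → ℝ[X]) (i j : Fin n) :
    IsPairFrame U V (Pi.single i (V j) - Pi.single j (V i))
      (Pi.single j (U i) - Pi.single i (U j)) (minor U V i j) := by
  constructor <;> simp only [dotProduct_sub, dotProduct_single, minor] <;> ring

/-- The universal point of the kernels of `U(t)`, `V(t)`. -/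
def paramVec {n : ℕ} (U V α β : Fin n → ℝ[X]) (δ : ℝ[X]) : Fin n → MvPolynomial (Fin n) ℝ[X] :=
  fun l => MvPolynomial.C δ * MvPolynomial.X l - linPoly U * MvPolynomial.C (α l) -
    linPoly V * MvPolynomial.C (β l)

/-- The point of the kernel of `U(τ)`, `V(τ)` with parameter `y`. -/
def paramPoint {n : ℕ} {B : Type*} [CommRing B] [Algebra ℝ B] (U V α β : Fin n → ℝ[X]) (δ : ℝ[X])
    (τ : B) (y : Fin n → B) : Fin n → B :=
  aeval τ δ • y - (evalVec τ U ⬝ᵥ y) • evalVec τ α - (evalVec τ V ⬝ᵥ y) • evalVec τ β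

/-- Evaluation of a polynomial with polynomial coefficients. -/
def evalPair {ι B : Type*} [CommRing B] [Algebra ℝ B] (τ : B) (y : ι → B) :
    MvPolynomial ι ℝ[X] →+* B :=
  MvPolynomial.eval₂Hom (aeval τ : ℝ[X] →ₐ[ℝ] B) y

section
variable {n : ℕ} {B : Type*} [CommRing B] [Algebra ℝ B] {U V α β : Fin n → ℝ[X]} {δ : ℝ[X]}

theorem evalPair_linPoly (τ : B) (y : Fin n → B) (U : Fin n → ℝ[X]) :
    evalPair τ y (linPoly U) = evalVec τ U ⬝ᵥ y := by
  simp [evalPair, linPoly, dotProduct, evalVec]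

theorem evalPair_paramVec (τ : B) (y : Fin n → B) (l : Fin n) :
    evalPair τ y (paramVec U V α β δ l) = paramPoint U V α β δ τ y l := by
  simp only [paramVec, map_sub, map_mul, evalPair_linPoly]
  simp [paramPoint, evalPair, evalVec]

theorem evalPair_aeval_paramVec (τ : B) (y : Fin n → B) (G : MvPolynomial (Fin n) ℝ) :
    evalPair τ y (MvPolynomial.aeval (paramVec U V α β δ) G) =
      MvPolynomial.aeval (paramPoint U V α β δ τ y) G := by
  rw [MvPolynomial.map_aeval, MvPolynomial.aeval_def, MvPolynomial.coe_eval₂Hom]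
  simp only [evalPair_paramVec]
  congr 1
  ext r
  rw [RingHom.comp_apply, IsScalarTower.algebraMap_apply ℝ ℝ[X] (MvPolynomial (Fin n) ℝ[X]),
    MvPolynomial.algebraMap_eq, evalPair, MvPolynomial.coe_eval₂Hom, MvPolynomial.eval₂_C,
    Polynomial.algebraMap_eq]
  exact aeval_C τ r

theorem IsPairFrame.paramPoint_left (h : IsPairFrame U V α β δ) (τ : B) (y : Fin n → B) :
    evalVec τ U ⬝ᵥ paramPoint U V α β δ τ y = 0 := by
  simp only [paramPoint, dotProduct_sub, dotProduct_smul, evalVec_dotProduct, h.aa, h.ab, map_zero,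
    smul_eq_mul]
  ring

theorem IsPairFrame.paramPoint_right (h : IsPairFrame U V α β δ) (τ : B) (y : Fin n → B) :
    evalVec τ V ⬝ᵥ paramPoint U V α β δ τ y = 0 := by
  simp only [paramPoint, dotProduct_sub, dotProduct_smul, evalVec_dotProduct, h.ba, h.bb, map_zero,
    smul_eq_mul]
  ring

theorem paramPoint_of_mem {τ : B} {y : Fin n → B} (hU : evalVec τ U ⬝ᵥ y = 0)
    (hV : evalVec τ V ⬝ᵥ y = 0) : paramPoint U V α β δ τ y = aeval τ δ • y := by
  simp [paramPoint, hU, hV]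

end

/-- `G` vanishes on the kernels of `U(t)`, `V(t)` for almost all real `t`. -/
def VanishesOn {n : ℕ} (U V : Fin n → ℝ[X]) (G : MvPolynomial (Fin n) ℝ) : Prop :=
  ∃ z : ℝ[X], z ≠ 0 ∧ ∀ t : ℝ, z.eval t ≠ 0 → ∀ x : Fin n → ℝ, evalVec t U ⬝ᵥ x = 0 →
    evalVec t V ⬝ᵥ x = 0 → MvPolynomial.aeval x G = 0

section
variable {n : ℕ} {U V α β : Fin n → ℝ[X]} {δ : ℝ[X]} {G : MvPolynomial (Fin n) ℝ}

theorem eq_zero_of_evalPair {ι : Type*} {F : MvPolynomial ι ℝ[X]} {z : ℝ[X]} (hz : z ≠ 0)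
    (h : ∀ t : ℝ, z.eval t ≠ 0 → ∀ y : ι → ℝ, evalPair t y F = 0) : F = 0 := by
  ext1 m
  rw [MvPolynomial.coeff_zero]
  refine (mul_eq_zero.1 (?_ : z * F.coeff m = 0)).resolve_left hz
  refine Polynomial.funext fun t => ?_
  rw [eval_mul, eval_zero]
  by_cases ht : z.eval t = 0
  · rw [ht, zero_mul]
  · have h1 : MvPolynomial.map (evalRingHom t) F = 0 := by
      refine MvPolynomial.funext fun y => ?_
      rw [MvPolynomial.eval_map, map_zero, ← h t ht y]
      rfl
    have h2 := congrArg (MvPolynomial.coeff m) h1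
    rw [MvPolynomial.coeff_map, MvPolynomial.coeff_zero] at h2
    rw [show (MvPolynomial.coeff m F).eval t = 0 from h2, mul_zero]

/-- The universal point lies in both kernels identically, so the pull-back of `G` vanishes at all
real specializations outside finitely many `t` and is the zero polynomial. -/
theorem VanishesOn.aeval_paramVec (h : VanishesOn U V G) (hf : IsPairFrame U V α β δ) :
    MvPolynomial.aeval (paramVec U V α β δ) G = 0 := by
  obtain ⟨z, hz, h⟩ := h
  refine eq_zero_of_evalPair hz fun t ht y => ?_
  rw [evalPair_aeval_paramVec]
  exact h t ht _ (hf.paramPoint_left t y) (hf.paramPoint_right t y)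

/-- A kernel vector is multiplied by `δ(τ)` under the parametrization; the parameter `δ(τ)⁻¹ x`
therefore yields `x` itself. -/
theorem aeval_eq_zero_of_aeval_paramVec (h : MvPolynomial.aeval (paramVec U V α β δ) G = 0)
    {B : Type*} [CommRing B] [Algebra ℝ B] {τ : B} (hδ : IsUnit (aeval τ δ)) {x : Fin n → B}
    (hU : evalVec τ U ⬝ᵥ x = 0) (hV : evalVec τ V ⬝ᵥ x = 0) : MvPolynomial.aeval x G = 0 := by
  obtain ⟨b, hb⟩ := hδ.exists_right_inv
  have h1 := evalPair_aeval_paramVec (U := U) (V := V) (α := α) (β := β) (δ := δ) τ (b • x) G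
  rw [h, map_zero, paramPoint_of_mem (by rw [dotProduct_smul, hU, smul_zero])
    (by rw [dotProduct_smul, hV, smul_zero]), smul_smul, hb, one_smul] at h1
  exact h1.symm

theorem vanishesOn_of_aeval_paramVec (hδ : δ ≠ 0)
    (h : MvPolynomial.aeval (paramVec U V α β δ) G = 0) : VanishesOn U V G :=
  ⟨δ, hδ, fun t ht _ hU hV => aeval_eq_zero_of_aeval_paramVec h
    (isUnit_iff_ne_zero.2 (by rwa [← coe_aeval_eq_eval] at ht)) hU hV⟩

/-- Polynomials vanishing on the real fibres vanish on the fibres over every `ℝ`-algebra. -/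
theorem VanishesOn.aeval_eq_zero (h : VanishesOn U V G) (hf : IsPairFrame U V α β δ)
    {B : Type*} [CommRing B] [Algebra ℝ B] {τ : B} (hδ : IsUnit (aeval τ δ)) {x : Fin n → B}
    (hU : evalVec τ U ⬝ᵥ x = 0) (hV : evalVec τ V ⬝ᵥ x = 0) : MvPolynomial.aeval x G = 0 :=
  aeval_eq_zero_of_aeval_paramVec (h.aeval_paramVec hf) hδ hU hV

end

/-! ### The chart at infinity -/

/-- The polynomial vector `t ^ deg P • P(1 / t)`. -/
def revVec {ι : Type*} [Fintype ι] (P : ι → ℝ[X]) : ι → ℝ[X] :=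
  fun i => (P i).reflect (vecDegree P)

theorem evalVec_zero_revVec {ι B : Type*} [Fintype ι] [CommRing B] [Algebra ℝ B] (P : ι → ℝ[X]) :
    evalVec (0 : B) (revVec P) = fun i => algebraMap ℝ B (leadVec P i) := by
  funext i
  rw [evalVec, revVec, aeval_def, eval₂_at_zero, coeff_reflect, leadVec]
  simp

theorem evalVec_revVec {ι : Type*} [Fintype ι] (P : ι → ℝ[X]) {s : ℝ} (hs : s ≠ 0) :
    evalVec s⁻¹ P = (s⁻¹ ^ vecDegree P) • evalVec s (revVec P) := by
  funext i
  have : Invertible (s⁻¹) := invertibleOfNonzero (inv_ne_zero hs)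
  have h := eval₂_reflect_mul_pow (algebraMap ℝ ℝ) s⁻¹ (vecDegree P) (P i)
    (natDegree_le_vecDegree P i)
  simp only [invOf_eq_inv, inv_inv] at h
  rw [evalVec, aeval_def, ← h, Pi.smul_apply, smul_eq_mul, mul_comm]
  rfl

theorem VanishesOn.revVec {n : ℕ} {P Q : Fin n → ℝ[X]} {G : MvPolynomial (Fin n) ℝ}
    (h : VanishesOn P Q G) : VanishesOn (revVec P) (revVec Q) G := by
  obtain ⟨z, hz, h⟩ := h
  -- The factor `X` excludes `s = 0`, where `t = 1 / s` is undefined.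
  refine ⟨X * z.reverse, mul_ne_zero X_ne_zero (reverse_eq_zero.not.2 hz), fun s hs x hP hQ => ?_⟩
  rw [eval_mul, eval_X, mul_ne_zero_iff] at hs
  obtain ⟨hs0, hs1⟩ := hs
  have : Invertible (s⁻¹) := invertibleOfNonzero (inv_ne_zero hs0)
  have hz' := eval₂_reverse_mul_pow (RingHom.id ℝ) s⁻¹ z
  simp only [invOf_eq_inv, inv_inv] at hz'
  refine h s⁻¹ ?_ x ?_ ?_
  · rw [eval, ← hz']
    exact mul_ne_zero hs1 (pow_ne_zero _ (inv_ne_zero hs0))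
  · rw [evalVec_revVec P hs0, smul_dotProduct, hP, smul_zero]
  · rw [evalVec_revVec Q hs0, smul_dotProduct, hQ, smul_zero]

/-! ### The ideal of the hypersurface -/

section
variable {n : ℕ} {M : Submodule ℝ[X] (Fin n → ℝ[X])} {P Q : Fin n → ℝ[X]}
  {G : MvPolynomial (Fin n) ℝ}

/-- No parameter is exceptional: at each `t` some minor of `P`, `Q` is nonzero and can serve as `δ`.
-/
theorem IsRegularPair.aeval_eq_zero (h : IsRegularPair M P Q) (hG : VanishesOn P Q G)
    {K : Type*} [Field K] [Algebra ℝ K] {t : K} {x : Fin n → K} (hP : evalVec t P ⬝ᵥ x = 0)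
    (hQ : evalVec t Q ⬝ᵥ x = 0) : MvPolynomial.aeval x G = 0 := by
  obtain ⟨i, j, hij⟩ := h.exists_aeval_minor_ne_zero t
  exact hG.aeval_eq_zero (isPairFrame_minor P Q i j) (isUnit_iff_ne_zero.2 hij) hP hQ

theorem IsRegularPair.aeval_eq_zero_of_lead (h : IsRegularPair M P Q) (hG : VanishesOn P Q G)
    {K : Type*} [Field K] [Algebra ℝ K] {x : Fin n → K}
    (hP : (fun i => algebraMap ℝ K (leadVec P i)) ⬝ᵥ x = 0)
    (hQ : (fun i => algebraMap ℝ K (leadVec Q i)) ⬝ᵥ x = 0) : MvPolynomial.aeval x G = 0 := by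
  obtain ⟨i, j, hij⟩ := h.lead
  rw [← evalVec_zero_revVec] at hP hQ
  refine hG.revVec.aeval_eq_zero (isPairFrame_minor _ _ i j) (isUnit_iff_ne_zero.2 ?_) hP hQ
  rw [← minor_evalVec, evalVec_zero_revVec, evalVec_zero_revVec]
  simp only [minor, ← map_mul, ← map_sub]
  exact (_root_.map_ne_zero _).2 hij

/-- The polynomials vanishing on the real points of the hypersurface of `M`. -/
def hypersurfaceIdeal (M : Submodule ℝ[X] (Fin n → ℝ[X])) : Ideal (MvPolynomial (Fin n) ℝ) :=
  MvPolynomial.vanishingIdeal ℝ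
    {x : Fin n → ℝ | ∃ hx : x ≠ 0, Projectivization.mk ℝ x hx ∈ ruledHypersurface M}

theorem aeval_zero_of_forall_smul {x : Fin n → ℝ}
    (h : ∀ s : ℝ, s ≠ 0 → MvPolynomial.aeval (s • x) G = 0) :
    MvPolynomial.aeval (0 : Fin n → ℝ) G = 0 := by
  set p : ℝ[X] := MvPolynomial.aeval (fun i => X * C (x i)) G
  have hp : ∀ s : ℝ, p.eval s = MvPolynomial.aeval (s • x) G := by
    intro s
    rw [← coe_aeval_eq_eval]
    change aeval s (MvPolynomial.aeval _ G) = _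
    rw [← AlgHom.comp_apply, MvPolynomial.comp_aeval]
    congr 2
    funext i
    rw [map_mul, aeval_X, aeval_C]
    rfl
  have hX : X * p = 0 := by
    refine Polynomial.funext fun s => ?_
    rw [eval_mul, eval_X, eval_zero, hp]
    by_cases hs : s = 0
    · rw [hs, zero_mul]
    · rw [h s hs, mul_zero]
  have h0 := hp 0
  rw [(mul_eq_zero.1 hX).resolve_left X_ne_zero, eval_zero, zero_smul] at h0
  exact h0.symm

theorem IsRegularPair.mk_mem_ruledHypersurface (h : IsRegularPair M P Q) {t : ℝ} {x : Fin n → ℝ}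
    (hx : x ≠ 0) (hP : evalVec t P ⬝ᵥ x = 0) (hQ : evalVec t Q ⬝ᵥ x = 0) :
    Projectivization.mk ℝ x hx ∈ ruledHypersurface M := by
  refine ⟨(t : OnePoint ℝ), ?_⟩
  rw [Projectivization.submodule_mk, Submodule.span_singleton_le_iff_mem]
  intro A hA
  obtain ⟨a, b, hab⟩ := h.exists_comb hA
  have : valueAt A (t : OnePoint ℝ) = a.eval t • evalVec t P + b.eval t • evalVec t Q := by
    funext i
    change (A i).eval t = _
    rw [hab i]
    simp [evalVec, coe_aeval_eq_eval]
  rw [this, add_dotProduct, smul_dotProduct, smul_dotProduct, hP, hQ, smul_zero, smul_zero,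
    add_zero]

/-- `VanishesOn` also tests the zero vector, which is no projective point; `hne` provides a line in
a fibre along which vanishing extends to the origin. -/
theorem IsRegularPair.mem_hypersurfaceIdeal_iff (h : IsRegularPair M P Q)
    (hne : ∃ (t : ℝ) (x : Fin n → ℝ), x ≠ 0 ∧ evalVec t P ⬝ᵥ x = 0 ∧ evalVec t Q ⬝ᵥ x = 0) :
    G ∈ hypersurfaceIdeal M ↔ VanishesOn P Q G := by
  rw [hypersurfaceIdeal, MvPolynomial.mem_vanishingIdeal_iff]
  constructor
  · intro hG
    refine ⟨1, one_ne_zero, fun t _ x hP hQ => ?_⟩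
    by_cases hx : x = 0
    · obtain ⟨t₀, x₀, hx₀, hP₀, hQ₀⟩ := hne
      rw [hx]
      refine aeval_zero_of_forall_smul (x := x₀) fun s hs => ?_
      refine hG _ ⟨smul_ne_zero hs hx₀, h.mk_mem_ruledHypersurface (t := t₀) _ ?_ ?_⟩
      · rw [dotProduct_smul, hP₀, smul_zero]
      · rw [dotProduct_smul, hQ₀, smul_zero]
    · exact hG x ⟨hx, h.mk_mem_ruledHypersurface hx hP hQ⟩
  · rintro hG x ⟨hx, t, ht⟩
    rw [Projectivization.submodule_mk, Submodule.span_singleton_le_iff_mem] at ht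
    have hP := ht P h.quasi.left_mem
    have hQ := ht Q h.quasi.right_mem
    induction t using OnePoint.rec with
    | infty => exact h.aeval_eq_zero_of_lead hG hP hQ
    | coe t => exact h.aeval_eq_zero hG (t := t) hP hQ

theorem IsRegularPair.exists_minor_ne_zero (h : IsRegularPair M P Q) :
    ∃ i j, minor P Q i j ≠ 0 :=
  CanalSurface.exists_minor_ne_zero h.quasi.wedge_ne_zero

/-- Vanishing on the fibres is the kernel condition of a ring homomorphism into the domain
`MvPolynomial (Fin n) ℝ[X]`: the incidence variety is irreducible. -/
theorem IsRegularPair.vanishesOn_mul (h : IsRegularPair M P Q) {G₁ G₂ : MvPolynomial (Fin n) ℝ}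
    (hG : VanishesOn P Q (G₁ * G₂)) : VanishesOn P Q G₁ ∨ VanishesOn P Q G₂ := by
  obtain ⟨i, j, hij⟩ := h.exists_minor_ne_zero
  have h0 := hG.aeval_paramVec (isPairFrame_minor P Q i j)
  rw [map_mul, mul_eq_zero] at h0
  exact h0.imp (vanishesOn_of_aeval_paramVec hij) (vanishesOn_of_aeval_paramVec hij)

theorem IsRegularPair.vanishesOn_resultant (h : IsRegularPair M P Q)
    (hd : vecDegree P + vecDegree Q ≠ 0) :
    VanishesOn P Q (resultant (linForm P) (linForm Q)) := by
  refine ⟨1, one_ne_zero, fun t _ x hP hQ => ?_⟩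
  rw [aeval_resultant_linForm h.left_ne_zero h.right_ne_zero]
  exact resultant_eq_zero_of_root (natDegree_dotPoly_le _ _) (natDegree_dotPoly_le _ _) hd
    (t := t) (by rw [eval_dotPoly, hP]) (by rw [eval_dotPoly, hQ])

/-- A complex zero of the resultant lies in a fibre over `ℙ¹(ℂ)`, vanishing leading coefficients
being the fibre at infinity. There `G` vanishes, and the Nullstellensatz applies. -/
theorem IsRegularPair.resultant_dvd_pow (h : IsRegularPair M P Q) (hG : VanishesOn P Q G) :
    ∃ N, resultant (linForm P) (linForm Q) ∣ G ^ N := by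
  set R := resultant (linForm P) (linForm Q)
  have hrad : G ∈ (Ideal.span {R}).radical := by
    rw [← MvPolynomial.vanishingIdeal_zeroLocus_eq_radical (K := ℂ),
      MvPolynomial.mem_vanishingIdeal_iff]
    intro x hx
    have hR : MvPolynomial.aeval x R = 0 := hx R (Ideal.mem_span_singleton_self R)
    rw [aeval_resultant_linForm h.left_ne_zero h.right_ne_zero] at hR
    rcases exists_root_of_resultant_eq_zero (natDegree_dotPoly_le _ _) (natDegree_dotPoly_le _ _)
      hR with ⟨t, h1, h2⟩ | ⟨h1, h2⟩
    · rw [eval_dotPoly] at h1 h2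
      exact h.aeval_eq_zero hG h1 h2
    · rw [coeff_dotPoly] at h1 h2
      exact h.aeval_eq_zero_of_lead hG h1 h2
  obtain ⟨N, hN⟩ := hrad
  exact ⟨N, Ideal.mem_span_singleton.1 hN⟩

/-- The ideal of the hypersurface is generated by an irreducible polynomial. -/
theorem IsRegularPair.exists_prime (h : IsRegularPair M P Q)
    (hd : vecDegree P + vecDegree Q ≠ 0) :
    ∃ F : MvPolynomial (Fin n) ℝ, Prime F ∧ ∀ G, VanishesOn P Q G ↔ F ∣ G := by
  set R := resultant (linForm P) (linForm Q)
  have hmul : ∀ {G₁ G₂}, VanishesOn P Q G₁ → VanishesOn P Q (G₁ * G₂) := by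
    rintro G₁ G₂ ⟨z, hz, h1⟩
    exact ⟨z, hz, fun t ht x hP hQ => by rw [map_mul, h1 t ht x hP hQ, zero_mul]⟩
  have h1 : ¬ VanishesOn P Q 1 := by
    rintro ⟨z, hz, h1⟩
    obtain ⟨t, ht⟩ : ∃ t, z.eval t ≠ 0 := by
      by_contra! h0
      exact hz (Polynomial.funext fun t => by rw [h0 t, eval_zero])
    have := h1 t ht 0 (dotProduct_zero _) (dotProduct_zero _)
    rw [map_one] at this
    exact one_ne_zero this
  have key : ∀ s : Multiset (MvPolynomial (Fin n) ℝ), VanishesOn P Q s.prod →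
      ∃ F ∈ s, VanishesOn P Q F := by
    intro s
    induction s using Multiset.induction with
    | empty => exact fun h0 => absurd h0 (by rwa [Multiset.prod_zero])
    | cons a s ih =>
      intro h0
      rw [Multiset.prod_cons] at h0
      rcases h.vanishesOn_mul h0 with h2 | h2
      · exact ⟨a, Multiset.mem_cons_self a s, h2⟩
      · obtain ⟨F, hF, h3⟩ := ih h2
        exact ⟨F, Multiset.mem_cons_of_mem hF, h3⟩
  -- Some prime factor `F` of the resultant vanishes on the fibres. It divides every other such
  -- polynomial `G`, because the resultant divides a power of `G`.
  obtain ⟨s, hs, u, hu⟩ := UniqueFactorizationMonoid.exists_prime_factors R h.resultant_ne_zero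
  have hR := hmul (G₂ := ↑u⁻¹) (h.vanishesOn_resultant hd)
  change VanishesOn P Q (R * _) at hR
  rw [← hu, mul_assoc, Units.mul_inv, mul_one] at hR
  obtain ⟨F, hF, hFv⟩ := key s hR
  refine ⟨F, hs F hF, fun G => ⟨fun hG => ?_, ?_⟩⟩
  · obtain ⟨N, hN⟩ := h.resultant_dvd_pow hG
    have hFR : F ∣ R := by
      rw [← hu]
      exact (Multiset.dvd_prod hF).mul_right _
    exact (hs F hF).dvd_of_dvd_pow (hFR.trans hN)
  · rintro ⟨G', rfl⟩
    exact hmul hFv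

theorem IsRegularPair.exists_resultant_eq (h : IsRegularPair M P Q)
    {F : MvPolynomial (Fin n) ℝ} (hF : Prime F) (hFv : VanishesOn P Q F) :
    ∃ (m : ℕ) (c : ℝ), c ≠ 0 ∧
      resultant (linForm P) (linForm Q) = MvPolynomial.C c * F ^ m := by
  obtain ⟨N, hN⟩ := h.resultant_dvd_pow hFv
  obtain ⟨m, -, u, hu⟩ := (dvd_prime_pow hF N).1 hN
  obtain ⟨c, hc, hcu⟩ := MvPolynomial.isUnit_iff_eq_C_of_isReduced.1 u⁻¹.isUnit
  refine ⟨m, c, hc.ne_zero, ?_⟩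
  rw [← hcu, ← hu, mul_comm, mul_assoc, Units.mul_inv, mul_one]

end

/-! ### First order deformations -/

section
variable {B : Type*} [CommRing B]

/-- The dual number `a + b ε`. -/
def dual (a b : B) : DualNumber B := TrivSqZeroExt.inl a + TrivSqZeroExt.inr b

@[simp] theorem fst_dual (a b : B) : (dual a b).fst = a := by simp [dual]

@[simp] theorem snd_dual (a b : B) : (dual a b).snd = b := by simp [dual]

theorem fst_dotProduct {n : ℕ} (u v : Fin n → DualNumber B) :
    (u ⬝ᵥ v).fst = (fun i => (u i).fst) ⬝ᵥ fun i => (v i).fst := by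
  simp [dotProduct, TrivSqZeroExt.fst_sum]

theorem snd_dotProduct {n : ℕ} (u v : Fin n → DualNumber B) :
    (u ⬝ᵥ v).snd = (fun i => (u i).fst) ⬝ᵥ (fun i => (v i).snd) +
      (fun i => (u i).snd) ⬝ᵥ fun i => (v i).fst := by
  simp only [dotProduct, TrivSqZeroExt.snd_sum, DualNumber.snd_mul, Finset.sum_add_distrib]

end

section
variable {B : Type*} [CommRing B] [Algebra ℝ B]

theorem fst_aeval {ι : Type*} (z : ι → DualNumber B) (G : MvPolynomial ι ℝ) :
    (MvPolynomial.aeval z G).fst = MvPolynomial.aeval (fun i => (z i).fst) G := by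
  change TrivSqZeroExt.fstHom ℝ B B (MvPolynomial.aeval z G) = _
  rw [← AlgHom.comp_apply, MvPolynomial.comp_aeval]
  rfl

theorem snd_algebraMap (r : ℝ) : (algebraMap ℝ (DualNumber B) r).snd = 0 := rfl

theorem snd_aeval {ι : Type*} [Fintype ι] (z : ι → DualNumber B) (G : MvPolynomial ι ℝ) :
    (MvPolynomial.aeval z G).snd =
      ∑ i, (z i).snd * MvPolynomial.aeval (fun i => (z i).fst) (MvPolynomial.pderiv i G) := by
  classical
  induction G using MvPolynomial.induction_on with
  | C r =>
    simp only [MvPolynomial.pderiv_C, map_zero, mul_zero, Finset.sum_const_zero,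
      MvPolynomial.aeval_C, snd_algebraMap]
  | add p q hp hq =>
    simp only [map_add, TrivSqZeroExt.snd_add, hp, hq, mul_add, Finset.sum_add_distrib]
  | mul_X p i hp =>
    have h1 : ∀ j, MvPolynomial.aeval (fun i => (z i).fst)
        (MvPolynomial.pderiv j (p * MvPolynomial.X i)) =
        MvPolynomial.aeval (fun i => (z i).fst) (MvPolynomial.pderiv j p) * (z i).fst +
        MvPolynomial.aeval (fun i => (z i).fst) p * (if i = j then 1 else 0) := by
      intro j
      rw [MvPolynomial.pderiv_mul, map_add, map_mul, map_mul, MvPolynomial.aeval_X,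
        MvPolynomial.pderiv_X, Pi.single_apply]
      congr 2
      by_cases hij : i = j
      · simp [hij]
      · simp [hij]
    rw [map_mul, MvPolynomial.aeval_X, DualNumber.snd_mul, hp, fst_aeval]
    simp only [h1, mul_add, Finset.sum_add_distrib, Finset.sum_mul, mul_ite, mul_one, mul_zero,
      Finset.sum_ite_eq, Finset.mem_univ, if_true]
    rw [add_comm]
    refine congrArg₂ _ (Finset.sum_congr rfl fun j _ => ?_) ?_ <;> ring

theorem fst_evalVec {ι : Type*} (τ : DualNumber B) (U : ι → ℝ[X]) (i : ι) :
    (evalVec τ U i).fst = evalVec τ.fst U i :=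
  (congrFun (evalVec_algHom (TrivSqZeroExt.fstHom ℝ B B) τ U) i).symm

theorem snd_evalVec {ι : Type*} (τ : DualNumber B) (U : ι → ℝ[X]) (i : ι) :
    (evalVec τ U i).snd = τ.snd * evalVec τ.fst (vecDeriv U) i := by
  simp only [evalVec, vecDeriv]
  induction U i using Polynomial.induction_on' with
  | add p q hp hq =>
    simp only [map_add, TrivSqZeroExt.snd_add, hp, hq, mul_add]
  | monomial m a =>
    rw [derivative_monomial, aeval_monomial, aeval_monomial, DualNumber.snd_mul, snd_algebraMap,
      zero_mul, add_zero, TrivSqZeroExt.snd_pow]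
    change algebraMap ℝ B a * _ = _
    rw [map_mul, map_natCast, Nat.pred_eq_sub_one]
    simp only [smul_eq_mul, nsmul_eq_mul]
    ring

/-- The incidence `U(t) · x = 0` to first order when `t` moves with speed `s` and `x` with velocity
`v`. -/
theorem evalVec_dual_dotProduct_eq_zero {n : ℕ} {U : Fin n → ℝ[X]} {t s : B} {x v : Fin n → B}
    (h0 : evalVec t U ⬝ᵥ x = 0) (h1 : evalVec t U ⬝ᵥ v + s * (evalVec t (vecDeriv U) ⬝ᵥ x) = 0) :
    evalVec (dual t s) U ⬝ᵥ (fun i => dual (x i) (v i)) = 0 := by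
  apply TrivSqZeroExt.ext
  · rw [fst_dotProduct]
    simp only [fst_evalVec, fst_dual]
    exact h0
  · rw [snd_dotProduct]
    simp only [fst_evalVec, fst_dual, snd_evalVec, snd_dual]
    rw [TrivSqZeroExt.snd_zero, ← h1]
    congr 1
    simp only [dotProduct, Finset.mul_sum, mul_assoc]

/-- The gradient of a polynomial at a point. -/
def gradAt {n : ℕ} (F : MvPolynomial (Fin n) ℝ) (x : Fin n → B) : Fin n → B :=
  fun i => MvPolynomial.aeval x (MvPolynomial.pderiv i F)

end

/-! ### Gradient and Hessian along the fibres: reflexivity -/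

theorem IsDualFrame.isPairFrame {n : ℕ} {A α β γ : Fin n → ℝ[X]} {δ : ℝ[X]}
    (h : IsDualFrame A α β γ δ) : IsPairFrame A (vecDeriv A) α β δ :=
  ⟨h.aa, h.ab, h.ba, h.bb⟩

section
variable {n : ℕ} {A α β γ : Fin n → ℝ[X]} {δ : ℝ[X]} {F : MvPolynomial (Fin n) ℝ}

/-- Tangent vectors of the hypersurface are annihilated by the gradient. -/
theorem IsDualFrame.dotProduct_gradAt (h : IsDualFrame A α β γ δ)
    (hF : VanishesOn A (vecDeriv A) F) {B : Type*} [CommRing B] [Algebra ℝ B] {t : B}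
    (hδ : IsUnit (aeval t δ)) {x v : Fin n → B} {s : B} (hx : evalVec t A ⬝ᵥ x = 0)
    (hx' : evalVec t (vecDeriv A) ⬝ᵥ x = 0) (hv : evalVec t A ⬝ᵥ v = 0)
    (hv' : evalVec t (vecDeriv A) ⬝ᵥ v + s * (evalVec t (vecDeriv (vecDeriv A)) ⬝ᵥ x) = 0) :
    v ⬝ᵥ gradAt F x = 0 := by
  have hu : IsUnit (aeval (dual t s) δ) := by
    rw [TrivSqZeroExt.isUnit_iff_isUnit_fst]
    have := fst_evalVec (dual t s) (fun _ : Unit => δ) ()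
    rw [fst_dual] at this
    simp only [evalVec] at this
    rwa [this]
  have h0 := hF.aeval_eq_zero h.isPairFrame hu
    (evalVec_dual_dotProduct_eq_zero (s := s) hx (by rw [hv, hx', mul_zero, zero_add]))
    (evalVec_dual_dotProduct_eq_zero hx' hv')
  have h1 := congrArg TrivSqZeroExt.snd h0
  rw [snd_aeval, TrivSqZeroExt.snd_zero] at h1
  simp only [snd_dual, fst_dual] at h1
  exact h1

/-- Any `y`, corrected by multiples of `α` and `β`, becomes tangent for any chosen speed `s`. The
case `y = 0`, `s = 1` kills the `β`-component of the gradient since `A'' · x` is not a zero divisor,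
and only a multiple of `A(t)` remains. A general ring `B` is needed for the later use over dual
numbers. -/
theorem IsDualFrame.exists_gradAt_eq_of_regular (h : IsDualFrame A α β γ δ)
    (hF : VanishesOn A (vecDeriv A) F) {B : Type*} [CommRing B] [Algebra ℝ B] {t : B}
    (hδ : IsUnit (aeval t δ)) {x : Fin n → B} (hx : evalVec t A ⬝ᵥ x = 0)
    (hx' : evalVec t (vecDeriv A) ⬝ᵥ x = 0)
    (hreg : ∀ b : B, (evalVec t (vecDeriv (vecDeriv A)) ⬝ᵥ x) * b = 0 → b = 0) :
    ∃ l : B, ∀ i, gradAt F x i = l * evalVec t A i := by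
  obtain ⟨d, hd⟩ := hδ.exists_right_inv
  set g := gradAt F x
  have key : ∀ (y : Fin n → B) (s : B), y ⬝ᵥ g = (evalVec t A ⬝ᵥ y) * d * (evalVec t α ⬝ᵥ g) +
      (evalVec t (vecDeriv A) ⬝ᵥ y + s * (evalVec t (vecDeriv (vecDeriv A)) ⬝ᵥ x)) * d *
        (evalVec t β ⬝ᵥ g) := by
    intro y s
    have h1 := h.dotProduct_gradAt hF hδ (s := s) hx hx'
      (v := y - ((evalVec t A ⬝ᵥ y) * d) • evalVec t α -
        ((evalVec t (vecDeriv A) ⬝ᵥ y + s * (evalVec t (vecDeriv (vecDeriv A)) ⬝ᵥ x)) * d) •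
          evalVec t β) (by
        simp only [dotProduct_sub, dotProduct_smul, evalVec_dotProduct, h.aa, h.ab, map_zero,
          smul_eq_mul]
        linear_combination -(evalVec t A ⬝ᵥ y) * hd) (by
        simp only [dotProduct_sub, dotProduct_smul, evalVec_dotProduct, h.ba, h.bb, map_zero,
          smul_eq_mul]
        linear_combination -(evalVec t (vecDeriv A) ⬝ᵥ y +
          s * (evalVec t (vecDeriv (vecDeriv A)) ⬝ᵥ x)) * hd)
    rw [sub_dotProduct, sub_dotProduct, smul_dotProduct, smul_dotProduct] at h1
    simp only [smul_eq_mul] at h1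
    linear_combination h1
  have hβ : d * (evalVec t β ⬝ᵥ g) = 0 := by
    apply hreg
    have := key 0 1
    simp only [zero_dotProduct, dotProduct_zero] at this
    linear_combination -this
  refine ⟨d * (evalVec t α ⬝ᵥ g), fun i => ?_⟩
  have := key (Pi.single i 1) 0
  rw [single_one_dotProduct, dotProduct_single_one] at this
  rw [this]
  linear_combination ((evalVec t (vecDeriv A) ⬝ᵥ Pi.single i 1) +
    0 * (evalVec t (vecDeriv (vecDeriv A)) ⬝ᵥ x)) * hβ

theorem gradAt_algHom {B B' : Type*} [CommRing B] [Algebra ℝ B] [CommRing B'] [Algebra ℝ B']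
    (φ : B →ₐ[ℝ] B') (x : Fin n → B) (i : Fin n) :
    gradAt F (fun j => φ (x j)) i = φ (gradAt F x i) := by
  rw [gradAt, gradAt, ← AlgHom.comp_apply, MvPolynomial.comp_aeval]

theorem algHom_dotProduct {B B' : Type*} [CommRing B] [Algebra ℝ B] [CommRing B'] [Algebra ℝ B']
    (φ : B →ₐ[ℝ] B') (u v : Fin n → B) :
    (fun i => φ (u i)) ⬝ᵥ (fun i => φ (v i)) = φ (u ⬝ᵥ v) := by
  simp [dotProduct, map_sum]

theorem eq_zero_of_C_add_X_mul_C {B : Type*} [CommRing B] {a c : B} (hc : IsUnit c) {b : B[X]}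
    (h : (C a + X * C c) * b = 0) : b = 0 := by
  obtain ⟨d, hd⟩ := hc.exists_right_inv
  refine ((monic_X_add_C (d * a)).mul_right_eq_zero_iff).1 ?_
  have hd' : C c * C d = (1 : B[X]) := by rw [← C_mul, hd, C_1]
  rw [C_mul]
  linear_combination C d * h - X * b * hd'

/-- The gradient of the implicit equation at a point of the fibre over `t` is proportional to
`A(t)`. -/
theorem IsDualFrame.exists_gradAt_eq (h : IsDualFrame A α β γ δ)
    (hF : VanishesOn A (vecDeriv A) F) {B : Type*} [CommRing B] [Algebra ℝ B] {t : B}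
    (hδ : IsUnit (aeval t δ)) {x : Fin n → B} (hx : evalVec t A ⬝ᵥ x = 0)
    (hx' : evalVec t (vecDeriv A) ⬝ᵥ x = 0) :
    ∃ l : B, ∀ i, gradAt F x i = l * evalVec t A i := by
  obtain ⟨φ, ψ, hφ, hψ⟩ : ∃ (φ : B →ₐ[ℝ] B[X]) (ψ : B[X] →ₐ[ℝ] B), (∀ b, φ b = C b) ∧
      ∀ p, ψ p = p.eval 0 :=
    ⟨CAlgHom, (aeval (0 : B)).restrictScalars ℝ, fun b => rfl, fun p => by
      rw [AlgHom.restrictScalars_apply, coe_aeval_eq_eval]⟩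
  -- Moving `x` to `x + X γ` stays in the fibre and turns `A'' · x` into `A'' · x + X δ`, which is
  -- not a zero divisor. Setting `X = 0` afterwards returns to `x`.
  set z : Fin n → B[X] := (fun i => φ (x i)) + (X : B[X]) • (fun i => φ (evalVec t γ i)) with hz
  have hdot : ∀ U : Fin n → ℝ[X], evalVec (φ t) U ⬝ᵥ z =
      φ (evalVec t U ⬝ᵥ x) + X * φ (aeval t (U ⬝ᵥ γ)) := by
    intro U
    rw [← evalVec_dotProduct, evalVec_algHom, ← algHom_dotProduct, ← algHom_dotProduct, hz,
      dotProduct_add, dotProduct_smul, smul_eq_mul]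
  have hδ' : IsUnit (aeval (φ t) δ) := by
    rw [aeval_algHom_apply]
    exact hδ.map φ
  obtain ⟨l, hl⟩ := h.exists_gradAt_eq_of_regular hF hδ' (x := z)
    (by rw [hdot, hx, h.ac, map_zero, map_zero, map_zero, mul_zero, add_zero])
    (by rw [hdot, hx', h.bc, map_zero, map_zero, map_zero, mul_zero, add_zero]) (by
      intro b hb
      rw [hdot, h.cc, hφ, hφ] at hb
      exact eq_zero_of_C_add_X_mul_C hδ hb)
  refine ⟨ψ l, fun i => ?_⟩
  have h1 := congrArg ψ (hl i)
  rw [map_mul, evalVec_algHom, ← gradAt_algHom] at h1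
  have h2 : (fun j => ψ (z j)) = x := by
    funext j
    simp only [hz, Pi.add_apply, Pi.smul_apply, smul_eq_mul, hψ, hφ, eval_add, eval_mul, eval_X, eval_C, zero_mul, add_zero]
  rw [h2] at h1
  rw [h1, hψ (φ _), hφ, eval_C]

/-- Proportionality of the gradient to `A(t)`, read over the dual numbers; the second equation is
its `ε`-part. -/
theorem IsDualFrame.exists_hessian_eq (h : IsDualFrame A α β γ δ)
    (hF : VanishesOn A (vecDeriv A) F) {B : Type*} [CommRing B] [Algebra ℝ B] {t : B}
    (hδ : IsUnit (aeval t δ)) {x v : Fin n → B} {s : B} (hx : evalVec t A ⬝ᵥ x = 0)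
    (hx' : evalVec t (vecDeriv A) ⬝ᵥ x = 0) (hv : evalVec t A ⬝ᵥ v = 0)
    (hv' : evalVec t (vecDeriv A) ⬝ᵥ v + s * (evalVec t (vecDeriv (vecDeriv A)) ⬝ᵥ x) = 0) :
    ∃ l m : B, ∀ i, gradAt F x i = l * evalVec t A i ∧
      v ⬝ᵥ gradAt (MvPolynomial.pderiv i F) x =
        m * evalVec t A i + l * (s * evalVec t (vecDeriv A) i) := by
  have hu : IsUnit (aeval (dual t s) δ) := by
    rw [TrivSqZeroExt.isUnit_iff_isUnit_fst]
    have := fst_evalVec (dual t s) (fun _ : Unit => δ) ()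
    rw [fst_dual] at this
    simp only [evalVec] at this
    rwa [this]
  obtain ⟨l, hl⟩ := h.exists_gradAt_eq hF hu
    (evalVec_dual_dotProduct_eq_zero (s := s) hx (by rw [hv, hx', mul_zero, zero_add]))
    (evalVec_dual_dotProduct_eq_zero hx' hv')
  refine ⟨l.fst, l.snd, fun i => ⟨?_, ?_⟩⟩
  · have h1 := congrArg TrivSqZeroExt.fst (hl i)
    rw [gradAt, fst_aeval, TrivSqZeroExt.fst_mul, fst_evalVec] at h1
    simp only [fst_dual] at h1
    exact h1
  · have h1 := congrArg TrivSqZeroExt.snd (hl i)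
    rw [gradAt, snd_aeval, DualNumber.snd_mul, fst_evalVec, snd_evalVec] at h1
    simp only [fst_dual, snd_dual] at h1
    change ∑ j, _ = _
    rw [add_comm]
    exact h1

/-- If `A'' · x = 0`, then `t` can move to first order while `x` stays fixed. The derivative of the
gradient relation becomes `m A + l A' = 0`, and pairing with `β` gives `l = 0`, so the gradient is
zero. -/
theorem IsDualFrame.second_ne_zero (h : IsDualFrame A α β γ δ)
    (hF : VanishesOn A (vecDeriv A) F) {K : Type*} [Field K] [Algebra ℝ K] {t : K}
    (hδ : aeval t δ ≠ 0) {x : Fin n → K} (hx : evalVec t A ⬝ᵥ x = 0)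
    (hx' : evalVec t (vecDeriv A) ⬝ᵥ x = 0) (hg : gradAt F x ≠ 0) :
    evalVec t (vecDeriv (vecDeriv A)) ⬝ᵥ x ≠ 0 := by
  intro h0
  obtain ⟨l, m, hlm⟩ := h.exists_hessian_eq hF (isUnit_iff_ne_zero.2 hδ) hx hx' (v := 0) (s := 1)
    (dotProduct_zero _) (by rw [dotProduct_zero, h0]; ring)
  apply hg
  have hl : l = 0 := by
    have h1 : ∑ i, (m * evalVec t A i + l * (1 * evalVec t (vecDeriv A) i)) * evalVec t β i = 0 :=
      Finset.sum_eq_zero fun i _ => by rw [← (hlm i).2, zero_dotProduct, zero_mul]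
    have h2 : m * (evalVec t A ⬝ᵥ evalVec t β) + l * (evalVec t (vecDeriv A) ⬝ᵥ evalVec t β) = 0 := by
      rw [← h1]
      simp only [dotProduct, Finset.mul_sum, ← Finset.sum_add_distrib]
      exact Finset.sum_congr rfl fun i _ => by ring
    rw [evalVec_dotProduct, evalVec_dotProduct, h.ab, h.bb, map_zero, mul_zero, zero_add] at h2
    exact (mul_eq_zero.1 h2).resolve_right hδ
  funext i
  rw [(hlm i).1, hl, zero_mul]
  rfl

/-- The hyperplane tangent to the curve at a smooth point of its dual hypersurface determines the
tangent line. -/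
theorem IsDualFrame.exists_minor_eq (h : IsDualFrame A α β γ δ)
    (hF : VanishesOn A (vecDeriv A) F) {K : Type*} [Field K] [Algebra ℝ K] {t t' : K}
    (hδ : aeval t δ ≠ 0) (hδ' : aeval t' δ ≠ 0) {x : Fin n → K} (hx : evalVec t A ⬝ᵥ x = 0)
    (hx' : evalVec t (vecDeriv A) ⬝ᵥ x = 0) (hy : evalVec t' A ⬝ᵥ x = 0)
    (hy' : evalVec t' (vecDeriv A) ⬝ᵥ x = 0) (hg : gradAt F x ≠ 0) :
    ∃ c : K, ∀ i j, aeval t (minor A (vecDeriv A) i j) =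
      c * aeval t' (minor A (vecDeriv A) i j) := by
  have hne := h.second_ne_zero hF hδ' hy hy' hg
  -- A tangent direction along which `t` moves with speed `1`. Since the gradient at `x` is
  -- proportional to both `A(t)` and `A(t')`, it is tangent for the fibre family at `t'` too, with
  -- some speed `s'`.
  set v : Fin n → K :=
    (-(evalVec t (vecDeriv (vecDeriv A)) ⬝ᵥ x) / aeval t δ) • evalVec t β with hvdef
  have hv : evalVec t A ⬝ᵥ v = 0 := by
    rw [hvdef, dotProduct_smul, evalVec_dotProduct, h.ab, map_zero, smul_zero]
  obtain ⟨l, m, hlm⟩ := h.exists_hessian_eq hF (isUnit_iff_ne_zero.2 hδ) hx hx' (v := v) (s := 1)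
    hv (by
      rw [hvdef, dotProduct_smul, evalVec_dotProduct, h.bb, smul_eq_mul]
      field_simp
      ring)
  have hzero : ∀ {l' : K} {t' : K}, (∀ i, gradAt F x i = l' * evalVec t' A i) → l' ≠ 0 := by
    rintro l' t' h1 rfl
    exact hg (funext fun i => by rw [h1 i, zero_mul]; rfl)
  have hl := hzero fun i => (hlm i).1
  obtain ⟨l₀, hl₀⟩ := h.exists_gradAt_eq hF (isUnit_iff_ne_zero.2 hδ') hy hy'
  have hv' : evalVec t' A ⬝ᵥ v = 0 := by
    refine (mul_eq_zero.1 (?_ : l₀ * _ = 0)).resolve_left (hzero hl₀)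
    have : l₀ * (evalVec t' A ⬝ᵥ v) = l * (evalVec t A ⬝ᵥ v) := by
      simp only [dotProduct, Finset.mul_sum, ← mul_assoc]
      exact Finset.sum_congr rfl fun i _ => by rw [← hl₀ i, ← (hlm i).1]
    rw [this, hv, mul_zero]
  obtain ⟨l', m', hlm'⟩ := h.exists_hessian_eq hF (isUnit_iff_ne_zero.2 hδ') hy hy' (v := v)
    (s := -(evalVec t' (vecDeriv A) ⬝ᵥ v) / (evalVec t' (vecDeriv (vecDeriv A)) ⬝ᵥ x))
    hv' (by field_simp; ring)
  generalize -(evalVec t' (vecDeriv A) ⬝ᵥ v) / (evalVec t' (vecDeriv (vecDeriv A)) ⬝ᵥ x) = s' at hlm'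
  -- The wedge of the gradient with its derivative along `v` is `l² A ∧ A'` at `t` and `l'² s' A ∧
  -- A'` at `t'`.
  refine ⟨l' ^ 2 * s' / l ^ 2, fun i j => ?_⟩
  have e1 : ∀ i, l * evalVec t A i = l' * evalVec t' A i := fun i => by
    rw [← (hlm i).1, (hlm' i).1]
  have e2 : ∀ i, m * evalVec t A i + l * (1 * evalVec t (vecDeriv A) i) =
      m' * evalVec t' A i + l' * (s' * evalVec t' (vecDeriv A) i) := fun i => by
    rw [← (hlm i).2, (hlm' i).2]
  rw [← minor_evalVec, ← minor_evalVec]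
  simp only [minor]
  field_simp
  generalize evalVec t A = a at *
  generalize evalVec t (vecDeriv A) = b at *
  generalize evalVec t' A = a' at *
  generalize evalVec t' (vecDeriv A) = b' at *
  linear_combination l * a i * e2 j - l * a j * e2 i
    + (m' * a' j + l' * s' * b' j) * e1 i - (m' * a' i + l' * s' * b' i) * e1 j

end

/-! ### Generic points of the hypersurface -/

theorem eventually_aeval_ne_zero {p : ℝ[X]} (hp : p ≠ 0) :
    ∀ᶠ t : ℂ in Filter.cofinite, aeval t p ≠ 0 := by
  rw [Filter.eventually_cofinite]
  have hp' : p.map (algebraMap ℝ ℂ) ≠ 0 := (Polynomial.map_ne_zero_iff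
    (algebraMap ℝ ℂ).injective).2 hp
  refine (p.map (algebraMap ℝ ℂ)).roots.toFinset.finite_toSet.subset fun t ht => ?_
  rw [Set.mem_ofPred_eq, not_not] at ht
  rw [Finset.mem_coe, Multiset.mem_toFinset, mem_roots hp', IsRoot.def, eval_map_algebraMap, ht]

theorem eventually_eval_ne_zero {p : ℂ[X]} (hp : p ≠ 0) :
    ∀ᶠ t : ℂ in Filter.cofinite, p.eval t ≠ 0 := by
  rw [Filter.eventually_cofinite]
  refine p.roots.toFinset.finite_toSet.subset fun t ht => ?_
  rw [Set.mem_ofPred_eq, not_not] at ht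
  rw [Finset.mem_coe, Multiset.mem_toFinset, mem_roots hp]
  exact ht

theorem eventually_map_aeval_ne_zero {ι : Type*} {Ψ : MvPolynomial ι ℝ[X]} (h : Ψ ≠ 0) :
    ∀ᶠ t : ℂ in Filter.cofinite,
      MvPolynomial.map ((aeval t : ℝ[X] →ₐ[ℝ] ℂ) : ℝ[X] →+* ℂ) Ψ ≠ 0 := by
  obtain ⟨m, hm⟩ := MvPolynomial.ne_zero_iff.1 h
  filter_upwards [eventually_aeval_ne_zero hm] with t ht h0
  apply ht
  have := congrArg (MvPolynomial.coeff m) h0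
  rwa [MvPolynomial.coeff_map, MvPolynomial.coeff_zero] at this

section
variable {n : ℕ} {A α β γ : Fin n → ℝ[X]} {δ : ℝ[X]} {F : MvPolynomial (Fin n) ℝ}

/-- The transposed form is `w = δ u - (u · α) A - (u · β) A'`. Were it identically zero, the nonzero
constant `u` would lie in the span of `A` and `A'`. -/
theorem IsDualFrame.eventually_dotProduct_paramPoint (h : IsDualFrame A α β γ δ) {u : Fin n → ℂ}
    (hu : u ≠ 0) : ∀ᶠ t : ℂ in Filter.cofinite, ∃ w : Fin n → ℂ, w ≠ 0 ∧
      ∀ y, u ⬝ᵥ paramPoint A (vecDeriv A) α β δ t y = w ⬝ᵥ y := by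
  let φ : ℝ[X] → ℂ[X] := Polynomial.map (algebraMap ℝ ℂ)
  let W : Fin n → ℂ[X] := fun l => φ δ * C (u l) - ((∑ i, C (u i) * φ (α i)) * φ (A l) +
    (∑ i, C (u i) * φ (β i)) * φ (derivative (A l)))
  have hW : ∃ l, W l ≠ 0 := by
    by_contra! h0
    exact hu (h.eq_zero_of_const ((Polynomial.map_ne_zero_iff (algebraMap ℝ ℂ).injective).2
      h.ne_zero) fun l => sub_eq_zero.1 (h0 l))
  obtain ⟨l, hl⟩ := hW
  have hsum : ∀ (t : ℂ) (V : Fin n → ℝ[X]), (∑ i, C (u i) * φ (V i)).eval t = u ⬝ᵥ evalVec t V := by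
    intro t V
    simp [eval_finsetSum, φ, dotProduct, evalVec, eval_map_algebraMap]
  filter_upwards [eventually_eval_ne_zero hl] with t ht
  refine ⟨fun l => (W l).eval t, fun h0 => ht (congrFun h0 l), fun y => ?_⟩
  have e : (fun l => (W l).eval t) = aeval t δ • u - ((u ⬝ᵥ evalVec t α) • evalVec t A +
      (u ⬝ᵥ evalVec t β) • evalVec t (vecDeriv A)) := by
    funext l
    simp only [W, eval_sub, eval_add, eval_mul, hsum, eval_C]
    simp only [φ, eval_map_algebraMap]
    rfl
  rw [e, sub_dotProduct, add_dotProduct, smul_dotProduct, smul_dotProduct, smul_dotProduct,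
    paramPoint, dotProduct_sub, dotProduct_sub, dotProduct_smul, dotProduct_smul, dotProduct_smul]
  simp only [smul_eq_mul]
  ring

/-- For almost all `t`, the fibre over `t` has a point at which the gradient of `F` and finitely
many given linear forms do not vanish. -/
theorem IsDualFrame.eventually_exists_point (h : IsDualFrame A α β γ δ)
    (hF : ∃ i, ¬ VanishesOn A (vecDeriv A) (MvPolynomial.pderiv i F)) (S : Finset (Fin n → ℂ))
    (hS : ∀ u ∈ S, u ≠ 0) :
    ∀ᶠ t : ℂ in Filter.cofinite, ∃ x : Fin n → ℂ, evalVec t A ⬝ᵥ x = 0 ∧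
      evalVec t (vecDeriv A) ⬝ᵥ x = 0 ∧ gradAt F x ≠ 0 ∧ ∀ u ∈ S, u ⬝ᵥ x ≠ 0 := by
  classical
  obtain ⟨i, hi⟩ := hF
  have hΨ : MvPolynomial.aeval (paramVec A (vecDeriv A) α β δ) (MvPolynomial.pderiv i F) ≠ 0 :=
    fun h0 => hi (vanishesOn_of_aeval_paramVec h.ne_zero h0)
  have hall := (Filter.eventually_all_finset S).2 fun u hu =>
    h.eventually_dotProduct_paramPoint (hS u hu)
  filter_upwards [eventually_map_aeval_ne_zero hΨ, hall] with t h1 h2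
  choose! w hw0 hw using h2
  obtain ⟨y, hy⟩ := exists_forall_eval_ne_zero
    (insert _ (S.image fun u => linPoly (w u))) (by
      intro f hf
      rcases Finset.mem_insert.1 hf with rfl | hf
      · exact h1
      · obtain ⟨u, hu, rfl⟩ := Finset.mem_image.1 hf
        exact linPoly_ne_zero (hw0 u hu))
  refine ⟨paramPoint A (vecDeriv A) α β δ t y, h.isPairFrame.paramPoint_left t y,
    h.isPairFrame.paramPoint_right t y, fun h0 => ?_, fun u hu => ?_⟩
  · apply hy _ (Finset.mem_insert_self _ _)
    rw [MvPolynomial.eval_map]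
    exact (evalPair_aeval_paramVec t y _).trans (congrFun h0 i)
  · rw [hw u hu, ← eval_linPoly]
    exact hy _ (Finset.mem_insert_of_mem (Finset.mem_image_of_mem _ hu))

/-- In characteristic zero some partial derivative is nonzero, and its degree is too small for a
multiple of `F`. Hence the gradient is not identically zero on the hypersurface. -/
theorem exists_not_dvd_pderiv {ι : Type*} {F : MvPolynomial ι ℝ} (hF : F.totalDegree ≠ 0) :
    ∃ i, ¬ F ∣ MvPolynomial.pderiv i F := by
  classical
  by_contra! h0
  obtain ⟨s, hs, i, hi⟩ : ∃ s ∈ F.support, ∃ i, s i ≠ 0 := by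
    by_contra! h1
    exact hF ((MvPolynomial.totalDegree_eq_zero_iff _ F).2 h1)
  set D := MvPolynomial.pderiv i F with hD
  have hD0 : D ≠ 0 := by
    intro h1
    have h2 := MvPolynomial.coeff_pderiv (i := i) F (s - Finsupp.single i 1)
    have h3 : s - Finsupp.single i 1 + Finsupp.single i 1 = s := by
      refine tsub_add_cancel_of_le ?_
      rw [Finsupp.single_le_iff]
      omega
    rw [← hD, h1, MvPolynomial.coeff_zero, h3] at h2
    refine mul_ne_zero (MvPolynomial.mem_support_iff.1 hs) ?_ h2.symm
    positivity
  have hlt : D.totalDegree + 1 ≤ F.totalDegree := by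
    rw [Nat.add_one_le_iff, MvPolynomial.totalDegree, Finset.sup_lt_iff (Nat.pos_of_ne_zero hF)]
    intro m hm
    have h1 := MvPolynomial.mem_support_iff.1 hm
    rw [hD, MvPolynomial.coeff_pderiv] at h1
    have h2 := MvPolynomial.le_totalDegree (MvPolynomial.mem_support_iff.2 (left_ne_zero_of_mul h1))
    rw [Finsupp.sum_add_index' (fun _ => rfl) (fun _ _ _ => rfl),
      Finsupp.sum_single_index rfl] at h2
    exact h2
  obtain ⟨E, hE⟩ := h0 i
  rw [← hD] at hE
  have hE0 : E ≠ 0 := by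
    rintro rfl
    exact hD0 (by rw [hE, mul_zero])
  have hF0 : F ≠ 0 := by
    rintro rfl
    exact hF MvPolynomial.totalDegree_zero
  have := MvPolynomial.totalDegree_mul_of_isDomain hF0 hE0
  rw [← hE] at this
  omega

end

/-! ### Change of quasi-generators -/

section
variable {n : ℕ} {M : Submodule ℝ[X] (Fin n → ℝ[X])} {P Q U V : Fin n → ℝ[X]}
  {a b a' b' : ℝ[X]} {G : MvPolynomial (Fin n) ℝ}

theorem dotProduct_comb {B : Type*} [CommRing B] [Algebra ℝ B] (hU : ∀ i, U i = a * P i + b * Q i)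
    (t : B) (x : Fin n → B) : evalVec t U ⬝ᵥ x =
      aeval t a * (evalVec t P ⬝ᵥ x) + aeval t b * (evalVec t Q ⬝ᵥ x) := by
  have : evalVec t U = aeval t a • evalVec t P + aeval t b • evalVec t Q := by
    funext i
    simp [evalVec, hU]
  rw [this, add_dotProduct, smul_dotProduct, smul_dotProduct]
  rfl

theorem minor_comb' (hU : ∀ i, U i = a * P i + b * Q i) (hV : ∀ i, V i = a' * P i + b' * Q i)
    (i j : Fin n) : minor U V i j = (a * b' - b * a') * minor P Q i j := by
  simp only [minor, hU, hV]
  ring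

theorem dotProduct_eq_zero_of_comb {K : Type*} [Field K] [Algebra ℝ K]
    (hU : ∀ i, U i = a * P i + b * Q i) (hV : ∀ i, V i = a' * P i + b' * Q i) {t : K}
    (hd : aeval t (a * b' - b * a') ≠ 0) {x : Fin n → K} (hUx : evalVec t U ⬝ᵥ x = 0)
    (hVx : evalVec t V ⬝ᵥ x = 0) : evalVec t P ⬝ᵥ x = 0 ∧ evalVec t Q ⬝ᵥ x = 0 := by
  rw [dotProduct_comb hU] at hUx
  rw [dotProduct_comb hV] at hVx
  simp only [map_sub, map_mul] at hd
  constructor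
  · refine mul_left_cancel₀ hd ?_
    rw [mul_zero]
    linear_combination aeval t b' * hUx - aeval t b * hVx
  · refine mul_left_cancel₀ hd ?_
    rw [mul_zero]
    linear_combination aeval t a * hVx - aeval t a' * hUx

theorem VanishesOn.of_comb (hG : VanishesOn P Q G) (hd : a * b' - b * a' ≠ 0)
    (hU : ∀ i, U i = a * P i + b * Q i) (hV : ∀ i, V i = a' * P i + b' * Q i) :
    VanishesOn U V G := by
  obtain ⟨z, hz, h⟩ := hG
  refine ⟨z * (a * b' - b * a'), mul_ne_zero hz hd, fun t ht x hUx hVx => ?_⟩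
  rw [eval_mul] at ht
  have hd' : aeval t (a * b' - b * a') ≠ 0 := by
    rw [coe_aeval_eq_eval]
    exact right_ne_zero_of_mul ht
  obtain ⟨h1, h2⟩ := dotProduct_eq_zero_of_comb hU hV hd' hUx hVx
  exact h t (left_ne_zero_of_mul ht) x h1 h2

theorem VanishesOn.comb (hG : VanishesOn U V G)
    (hU : ∀ i, U i = a * P i + b * Q i) (hV : ∀ i, V i = a' * P i + b' * Q i) :
    VanishesOn P Q G := by
  obtain ⟨z, hz, h⟩ := hG
  refine ⟨z, hz, fun t ht x hPx hQx => h t ht x ?_ ?_⟩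
  · rw [dotProduct_comb hU, hPx, hQx, mul_zero, mul_zero, add_zero]
  · rw [dotProduct_comb hV, hPx, hQx, mul_zero, mul_zero, add_zero]

/-- Proportional Plücker coordinates belong to equal kernels. -/
theorem dotProduct_eq_zero_of_minor_eq {K : Type*} [Field K] {u v u' v' x : Fin n → K} {c : K}
    (h : ∀ i j, minor u v i j = c * minor u' v' i j) (hne : ∃ i j, minor u v i j ≠ 0)
    (hu : u' ⬝ᵥ x = 0) (hv : v' ⬝ᵥ x = 0) : u ⬝ᵥ x = 0 ∧ v ⬝ᵥ x = 0 := by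
  have hsum : ∀ (u v : Fin n → K) (i : Fin n), ∑ j, minor u v i j * x j =
      u i * (v ⬝ᵥ x) - v i * (u ⬝ᵥ x) := by
    intro u v i
    simp only [minor, dotProduct, Finset.mul_sum, ← Finset.sum_sub_distrib]
    exact Finset.sum_congr rfl fun j _ => by ring
  have key : ∀ i, u i * (v ⬝ᵥ x) - v i * (u ⬝ᵥ x) = 0 := by
    intro i
    have : c * (u' i * (v' ⬝ᵥ x) - v' i * (u' ⬝ᵥ x)) = u i * (v ⬝ᵥ x) - v i * (u ⬝ᵥ x) := by
      rw [← hsum, ← hsum, Finset.mul_sum]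
      exact Finset.sum_congr rfl fun j _ => by rw [h]; ring
    rw [← this, hu, hv]
    ring
  obtain ⟨i, j, hij⟩ := hne
  constructor
  · refine (mul_eq_zero.1 (?_ : minor u v i j * _ = 0)).resolve_left hij
    simp only [minor]
    linear_combination u j * key i - u i * key j
  · refine (mul_eq_zero.1 (?_ : minor u v i j * _ = 0)).resolve_left hij
    simp only [minor]
    linear_combination v j * key i - v i * key j

end

/-! ### The order of the resultant at a generic point -/

/-- Taylor expansion of `F` on a line to first order, obtained by sending the line parameter to `ε`.
-/
theorem exists_aeval_line_eq {n : ℕ} {F : MvPolynomial (Fin n) ℝ} {x v : Fin n → ℂ}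
    (hF : MvPolynomial.aeval x F = 0) : ∃ Φ : ℂ[X],
      MvPolynomial.aeval ((fun i => C (x i)) + (X : ℂ[X]) • fun i => C (v i)) F = X * Φ ∧
        Φ.eval 0 = v ⬝ᵥ gradAt F x := by
  set z : Fin n → ℂ[X] := (fun i => C (x i)) + (X : ℂ[X]) • fun i => C (v i) with hz
  obtain ⟨χ, hχ⟩ : ∃ χ : ℂ[X] →ₐ[ℝ] DualNumber ℂ, ∀ p, χ p = aeval (dual 0 1 : DualNumber ℂ) p :=
    ⟨(aeval (dual 0 1 : DualNumber ℂ)).restrictScalars ℝ, fun _ => rfl⟩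
  have hfst : ∀ p, (χ p).fst = p.eval 0 := by
    intro p
    rw [hχ]
    have := aeval_algHom_apply (TrivSqZeroExt.fstHom ℂ ℂ ℂ) (dual 0 1 : DualNumber ℂ) p
    rw [← coe_aeval_eq_eval]
    change TrivSqZeroExt.fstHom ℂ ℂ ℂ _ = _
    rw [← this]
    congr 2
    exact fst_dual 0 1
  have hχz : (fun i => χ (z i)) = fun i => dual (x i) (v i) := by
    funext i
    simp only [hz, Pi.add_apply, Pi.smul_apply, smul_eq_mul, map_add, map_mul, hχ, aeval_X, aeval_C]
    apply TrivSqZeroExt.ext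
    · simp [TrivSqZeroExt.algebraMap_eq_inl]
    · simp [TrivSqZeroExt.algebraMap_eq_inl]
  have hval : χ (MvPolynomial.aeval z F) = MvPolynomial.aeval (fun i => dual (x i) (v i)) F := by
    rw [← AlgHom.comp_apply, MvPolynomial.comp_aeval, hχz]
  obtain ⟨Φ, hΦ⟩ : X ∣ MvPolynomial.aeval z F := by
    rw [X_dvd_iff, coeff_zero_eq_eval_zero, ← hfst, hval, fst_aeval]
    simpa only [fst_dual] using hF
  refine ⟨Φ, hΦ, ?_⟩
  have h1 := congrArg TrivSqZeroExt.snd hval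
  rw [hΦ, map_mul, DualNumber.snd_mul, hfst, hfst, hχ X, aeval_X, snd_dual, eval_X, zero_mul,
    zero_add, one_mul, snd_aeval] at h1
  simp only [snd_dual, fst_dual] at h1
  exact h1

theorem dotPoly_line {n : ℕ} (P : Fin n → ℝ[X]) (x v : Fin n → ℂ) :
    dotPoly P ((fun i => C (x i)) + (X : ℂ[X]) • fun i => C (v i)) =
      (dotPoly P x).map (C : ℂ →+* ℂ[X]) + C X * (dotPoly P v).map C := by
  rw [dotPoly_add_smul]
  have := fun y : Fin n → ℂ => map_dotPoly (CAlgHom : ℂ →ₐ[ℝ] ℂ[X]) P y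
  exact congrArg₂ _ (this x).symm (congrArg₂ _ rfl (this v).symm)

section
variable {n : ℕ} {M : Submodule ℝ[X] (Fin n → ℝ[X])} {P Q A α β γ : Fin n → ℝ[X]}
  {δ a b a' b' : ℝ[X]} {F : MvPolynomial (Fin n) ℝ}

theorem IsDualFrame.mem_dotProduct_third (h : IsDualFrame A α β γ δ) {U : Fin n → ℝ[X]}
    (hU : U ∈ quasiSpan A (vecDeriv A)) : U ⬝ᵥ γ = 0 := by
  obtain ⟨c, a, b, hc, hab⟩ := mem_quasiSpan_iff.1 hU
  have : c * (U ⬝ᵥ γ) = a * (A ⬝ᵥ γ) + b * (vecDeriv A ⬝ᵥ γ) := by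
    simp only [dotProduct, Finset.mul_sum, ← Finset.sum_add_distrib, ← mul_assoc]
    refine Finset.sum_congr rfl fun i _ => ?_
    rw [hab]; ring
  rw [h.ac, h.bc, mul_zero, mul_zero, add_zero] at this
  exact (mul_eq_zero.1 this).resolve_left hc

/-- The third frame vector `γ(t)` lies in the fibre over `t` and is nonzero where `δ(t) ≠ 0`. -/
theorem IsDualFrame.exists_real_point (h : IsDualFrame A α β γ δ)
    (hPQ : IsRegularPair (quasiSpan A (vecDeriv A)) P Q) :
    ∃ (t : ℝ) (x : Fin n → ℝ), x ≠ 0 ∧ evalVec t P ⬝ᵥ x = 0 ∧ evalVec t Q ⬝ᵥ x = 0 := by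
  obtain ⟨t, ht⟩ : ∃ t, δ.eval t ≠ 0 := by
    by_contra! h0
    exact h.ne_zero (Polynomial.funext fun t => by rw [h0 t, eval_zero])
  refine ⟨t, evalVec t γ, fun h0 => ht ?_, ?_, ?_⟩
  · rw [← coe_aeval_eq_eval, ← h.cc, ← evalVec_dotProduct, h0, dotProduct_zero]
  · rw [evalVec_dotProduct, h.mem_dotProduct_third hPQ.quasi.left_mem, map_zero]
  · rw [evalVec_dotProduct, h.mem_dotProduct_third hPQ.quasi.right_mem, map_zero]

theorem IsDualFrame.vecDegree_add_ne_zero (h : IsDualFrame A α β γ δ)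
    (hPQ : IsRegularPair (quasiSpan A (vecDeriv A)) P Q) : vecDegree P + vecDegree Q ≠ 0 := by
  intro hd
  have hP : vecDegree P = 0 := by omega
  obtain ⟨c, a, b, hc, hab⟩ := mem_quasiSpan_iff.1 hPQ.quasi.left_mem
  have hconst : ∀ i, P i = C ((P i).coeff 0) := fun i =>
    eq_C_of_natDegree_eq_zero (Nat.le_zero.1 (hP ▸ natDegree_le_vecDegree P i))
  have := h.eq_zero_of_const (K := ℝ) hc (u := fun i => (P i).coeff 0) (a := a) (b := b) fun i => by
    rw [← hconst, hab i]
    simp [vecDeriv]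
  apply hPQ.left_ne_zero
  funext i
  rw [hconst i, show (P i).coeff 0 = 0 from congrFun this i, C_0]
  rfl

/-- The matrix of pairings of `A`, `A'` with `α`, `β` is `δ` times the identity and factors through
the pairings of `P`, `Q`. So the transition matrix is invertible wherever `δ` is nonzero. -/
theorem IsDualFrame.det_dvd (h : IsDualFrame A α β γ δ) (hA : ∀ i, A i = a * P i + b * Q i)
    (hA' : ∀ i, vecDeriv A i = a' * P i + b' * Q i) : a * b' - b * a' ∣ δ ^ 2 := by
  have hdot : ∀ {U V : Fin n → ℝ[X]} {c d : ℝ[X]}, (∀ i, U i = c * P i + d * Q i) →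
      U ⬝ᵥ V = c * (P ⬝ᵥ V) + d * (Q ⬝ᵥ V) := by
    intro U V c d hU
    simp only [dotProduct, Finset.mul_sum, ← Finset.sum_add_distrib]
    exact Finset.sum_congr rfl fun i _ => by rw [hU]; ring
  have h1 := h.aa
  have h2 := h.ab
  have h3 := h.ba
  have h4 := h.bb
  rw [hdot hA] at h1 h2
  rw [hdot hA'] at h3 h4
  refine ⟨(P ⬝ᵥ α) * (Q ⬝ᵥ β) - (P ⬝ᵥ β) * (Q ⬝ᵥ α), ?_⟩
  linear_combination (-δ) * h1 - (a * (P ⬝ᵥ α) + b * (Q ⬝ᵥ α)) * h4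
    + (a * (P ⬝ᵥ β) + b * (Q ⬝ᵥ β)) * h3

/-- At a generic point of the hypersurface the multiplicity of the resultant is the number of
fibres through this point. -/
theorem IsDualFrame.card_fibres_eq (h : IsDualFrame A α β γ δ)
    (hPQ : IsRegularPair M P Q) (hA : ∀ i, A i = a * P i + b * Q i)
    (hA' : ∀ i, vecDeriv A i = a' * P i + b' * Q i) (hF : VanishesOn A (vecDeriv A) F)
    (hFP : VanishesOn P Q F) {m : ℕ} {c : ℝ} (hc : c ≠ 0)
    (hR : resultant (linForm P) (linForm Q) = MvPolynomial.C c * F ^ m) {x : Fin n → ℂ}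
    (hg : gradAt F x ≠ 0) (hlP : (fun i => algebraMap ℝ ℂ (leadVec P i)) ⬝ᵥ x ≠ 0)
    (hlQ : (fun i => algebraMap ℝ ℂ (leadVec Q i)) ⬝ᵥ x ≠ 0)
    (hT : ∀ t : ℂ, aeval t δ = 0 → evalVec t P ⬝ᵥ x ≠ 0) {t₀ : ℂ}
    (ht₀ : evalVec t₀ P ⬝ᵥ x = 0 ∧ evalVec t₀ Q ⬝ᵥ x = 0) :
    {t : ℂ | evalVec t P ⬝ᵥ x = 0 ∧ evalVec t Q ⬝ᵥ x = 0}.encard = m := by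
  classical
  set f := dotPoly P x with hf
  set g := dotPoly Q x with hg'
  rw [← coeff_dotPoly] at hlP hlQ
  have hfd : f.natDegree = vecDegree P :=
    natDegree_eq_of_le_of_coeff_ne_zero (natDegree_dotPoly_le P x) hlP
  have hgd : g.natDegree = vecDegree Q :=
    natDegree_eq_of_le_of_coeff_ne_zero (natDegree_dotPoly_le Q x) hlQ
  have hf0 : f ≠ 0 := fun h0 => hlP (by rw [← hf, h0, coeff_zero])
  have hg0 : g ≠ 0 := fun h0 => hlQ (by rw [← hg', h0, coeff_zero])
  obtain ⟨v, hv⟩ := exists_forall_dotProduct_ne_zero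
    (insert (gradAt F x) (f.roots.toFinset.image fun t => evalVec t P)) (by
      intro u hu
      rcases Finset.mem_insert.1 hu with rfl | hu
      · exact hg
      · obtain ⟨t, -, rfl⟩ := Finset.mem_image.1 hu
        exact hPQ.evalVec_left_ne_zero t)
  have hgv := hv _ (Finset.mem_insert_self _ _)
  set Z := f.roots.toFinset.filter fun t => g.eval t = 0
  have hZ : ∀ t, t ∈ Z ↔ f.eval t = 0 ∧ g.eval t = 0 := by
    intro t
    rw [Finset.mem_filter, Multiset.mem_toFinset, mem_roots hf0, IsRoot.def]
  have hfv : ∀ t, f.eval t = 0 → (dotPoly P v).eval t ≠ 0 := by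
    intro t ht
    rw [eval_dotPoly]
    exact hv _ (Finset.mem_insert_of_mem (Finset.mem_image_of_mem _
      (Multiset.mem_toFinset.2 ((mem_roots hf0).2 ht))))
  -- A multiple Jacobian root means `(P'·x)(Q·v) = (P·v)(Q'·x)`. Together with `A' · x = 0` and `A ·
  -- v ≠ 0` this forces `P' · x = Q' · x = 0`, hence `A'' · x = 0`, contrary to `second_ne_zero`.
  have hw : ∀ t ∈ Z, (derivative (f * dotPoly Q v - dotPoly P v * g)).eval t ≠ 0 := by
    intro t ht h0
    obtain ⟨h1, h2⟩ := (hZ t).1 ht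
    rw [derivative_sub, derivative_mul, derivative_mul, eval_sub, eval_add, eval_add, eval_mul,
      eval_mul, eval_mul, eval_mul, h1, h2, hf, hg'] at h0
    simp only [derivative_dotPoly, eval_dotPoly, zero_mul, mul_zero, add_zero, zero_add] at h0
    rw [hf, eval_dotPoly] at h1
    rw [hg', eval_dotPoly] at h2
    have hδ : aeval t δ ≠ 0 := fun h3 => hT t h3 h1
    have hx : evalVec t A ⬝ᵥ x = 0 := by
      rw [dotProduct_comb hA, h1, h2, mul_zero, mul_zero, add_zero]
    have hx' : evalVec t (vecDeriv A) ⬝ᵥ x = 0 := by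
      rw [dotProduct_comb hA', h1, h2, mul_zero, mul_zero, add_zero]
    have hder : ∀ {U : Fin n → ℝ[X]} {c d : ℝ[X]}, (∀ i, U i = c * P i + d * Q i) →
        evalVec t (vecDeriv U) ⬝ᵥ x = aeval t c * (evalVec t (vecDeriv P) ⬝ᵥ x) +
          aeval t d * (evalVec t (vecDeriv Q) ⬝ᵥ x) := by
      intro U c d hU
      have e : evalVec t (vecDeriv U) = (aeval t (derivative c) • evalVec t P +
          aeval t (derivative d) • evalVec t Q) + (aeval t c • evalVec t (vecDeriv P) +
          aeval t d • evalVec t (vecDeriv Q)) := by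
        funext i
        simp only [evalVec, vecDeriv, hU, derivative_mul, map_add, map_mul,
          Pi.add_apply, Pi.smul_apply, smul_eq_mul]
        ring
      rw [e, add_dotProduct, add_dotProduct, smul_dotProduct, smul_dotProduct, h1, h2,
        smul_zero, smul_zero, zero_add, zero_add, add_dotProduct, smul_dotProduct,
        smul_dotProduct]
      rfl
    have h3 := h.second_ne_zero hF hδ hx hx' hg
    rw [hder hA'] at h3
    have h4 := hx'
    rw [hder hA] at h4
    obtain ⟨l, hl⟩ := h.exists_gradAt_eq hF (isUnit_iff_ne_zero.2 hδ) hx hx'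
    have h5 : gradAt F x ⬝ᵥ v = l * (evalVec t A ⬝ᵥ v) := by
      simp only [dotProduct, Finset.mul_sum, ← mul_assoc]
      exact Finset.sum_congr rfl fun i _ => by rw [hl i]
    rw [h5, dotProduct_comb hA] at hgv
    have h6 := right_ne_zero_of_mul hgv
    generalize evalVec t (vecDeriv P) ⬝ᵥ x = p at *
    generalize evalVec t (vecDeriv Q) ⬝ᵥ x = q at *
    generalize evalVec t P ⬝ᵥ v = pv at *
    generalize evalVec t Q ⬝ᵥ v = qv at *
    have hp : p = 0 := by
      refine (mul_eq_zero.1 (?_ : p * _ = 0)).resolve_right h6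
      linear_combination aeval t b * h0 + pv * h4
    have hq : q = 0 := by
      refine (mul_eq_zero.1 (?_ : q * _ = 0)).resolve_right h6
      linear_combination (-aeval t a) * h0 + qv * h4
    exact h3 (by rw [hp, hq]; ring)
  obtain ⟨c₁, T, hc₁, hT0, hpencil⟩ := exists_resultant_pencil_eq hfd hgd hf0 hg0
    (natDegree_dotPoly_le P v) (natDegree_dotPoly_le Q v) Z hZ hw hfv
  obtain ⟨Φ, hΦ, hΦ0⟩ := exists_aeval_line_eq (v := v) (hPQ.aeval_eq_zero hFP ht₀.1 ht₀.2)
  have hres := aeval_resultant_linForm hPQ.left_ne_zero hPQ.right_ne_zero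
    ((fun i => C (x i)) + (X : ℂ[X]) • fun i => C (v i))
  rw [hR, map_mul, map_pow, hΦ, dotPoly_line, dotPoly_line, ← hf, ← hg', MvPolynomial.aeval_C]
    at hres
  rw [← hres] at hpencil
  -- On the line each factor `F` contributes exactly one power of the parameter, as the gradient
  -- does not annihilate `v`.
  have hm : m = Z.card := by
    refine eq_of_X_pow_mul_eq (a := C c₁ * algebraMap ℝ ℂ[X] c * Φ ^ m) ?_ hT0 ?_
    · rw [eval_mul, eval_mul, eval_C, eval_pow, hΦ0, dotProduct_comm]
      refine mul_ne_zero (mul_ne_zero hc₁ ?_) (pow_ne_zero _ hgv)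
      rw [IsScalarTower.algebraMap_apply ℝ ℂ ℂ[X], Polynomial.algebraMap_eq, eval_C]
      exact (_root_.map_ne_zero _).2 hc
    · rw [← hpencil]
      ring
  have hset : {t : ℂ | evalVec t P ⬝ᵥ x = 0 ∧ evalVec t Q ⬝ᵥ x = 0} = (Z : Set ℂ) := by
    ext t
    rw [Finset.mem_coe, hZ, hf, hg', eval_dotPoly, eval_dotPoly]
    rfl
  rw [hset, Set.encard_coe_eq_coe_finsetCard, hm]

theorem totalDegree_C_mul_pow {σ : Type*} {F : MvPolynomial σ ℝ} (hF : F ≠ 0) {c : ℝ} (hc : c ≠ 0)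
    (m : ℕ) : (MvPolynomial.C c * F ^ m).totalDegree = m * F.totalDegree := by
  have hpow : (F ^ m).totalDegree = m * F.totalDegree := by
    induction m with
    | zero => simp
    | succ m ih =>
      rw [pow_succ, MvPolynomial.totalDegree_mul_of_isDomain (pow_ne_zero _ hF) hF, ih]
      ring
  rw [MvPolynomial.totalDegree_mul_of_isDomain (by simpa using hc) (pow_ne_zero _ hF),
    MvPolynomial.totalDegree_C, zero_add, hpow]

theorem IsRegularPair.mul_totalDegree_eq (h : IsRegularPair M P Q) (hF : F ≠ 0) {m : ℕ} {c : ℝ}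
    (hc : c ≠ 0) (hR : resultant (linForm P) (linForm Q) = MvPolynomial.C c * F ^ m) :
    m * F.totalDegree = vecDegree P + vecDegree Q := by
  rw [← totalDegree_C_mul_pow hF hc, ← hR]
  exact (isHomogeneous_resultant_linForm h.left_ne_zero h.right_ne_zero).totalDegree
    h.resultant_ne_zero

end

/-! ### The parametrization degree and the main theorem -/

/-- The degree of the parametrization by tangent lines is the multiplicity of the resultant. -/
theorem IsDualFrame.isParamDegree {n : ℕ} {A P Q α β γ : Fin n → ℝ[X]} {δ : ℝ[X]}
    {F : MvPolynomial (Fin n) ℝ} (h : IsDualFrame A α β γ δ)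
    (hPQ : IsRegularPair (quasiSpan A (vecDeriv A)) P Q) (hFP : VanishesOn P Q F)
    (hFd : ∃ i, ¬ VanishesOn P Q (MvPolynomial.pderiv i F)) {m : ℕ} {c : ℝ} (hc : c ≠ 0)
    (hR : resultant (linForm P) (linForm Q) = MvPolynomial.C c * F ^ m) :
    IsParamDegree (wedge A (vecDeriv A)) m := by
  classical
  obtain ⟨a, b, hA⟩ := hPQ.exists_comb (left_mem_quasiSpan A (vecDeriv A))
  obtain ⟨a', b', hA'⟩ := hPQ.exists_comb (right_mem_quasiSpan A (vecDeriv A))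
  have hdvd := h.det_dvd hA hA'
  have hdet : a * b' - b * a' ≠ 0 := fun h0 =>
    pow_ne_zero 2 h.ne_zero (zero_dvd_iff.1 (h0 ▸ hdvd))
  have hdet' : ∀ t : ℂ, aeval t δ ≠ 0 → aeval t (a * b' - b * a') ≠ 0 := by
    intro t ht h0
    obtain ⟨e, he⟩ := hdvd
    have := congrArg (aeval t) he
    rw [map_mul, h0, zero_mul, map_pow] at this
    exact pow_ne_zero 2 ht this
  have hF : VanishesOn A (vecDeriv A) F := hFP.of_comb hdet hA hA'
  have hFd' : ∃ i, ¬ VanishesOn A (vecDeriv A) (MvPolynomial.pderiv i F) :=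
    hFd.imp fun i hi h0 => hi (h0.comb hA hA')
  -- Forms that must not vanish at `x`: the leading vectors, so that no degree drops, and `P(t)` at
  -- the zeros of `δ`, so that no fibre through `x` lies over such a `t`.
  set S : Finset (Fin n → ℂ) := {fun i => algebraMap ℝ ℂ (leadVec P i),
    fun i => algebraMap ℝ ℂ (leadVec Q i)} ∪
    (δ.map (algebraMap ℝ ℂ)).roots.toFinset.image fun t => evalVec t P with hS
  have hS0 : ∀ u ∈ S, u ≠ 0 := by
    intro u hu
    rcases Finset.mem_union.1 hu with hu | hu
    · rcases Finset.mem_insert.1 hu with rfl | hu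
      · exact map_leadVec_ne_zero hPQ.left_ne_zero
      · rw [Finset.mem_singleton.1 hu]
        exact map_leadVec_ne_zero hPQ.right_ne_zero
    · obtain ⟨t, -, rfl⟩ := Finset.mem_image.1 hu
      exact hPQ.evalVec_left_ne_zero t
  have hδ0 : δ.map (algebraMap ℝ ℂ) ≠ 0 :=
    (Polynomial.map_ne_zero_iff (algebraMap ℝ ℂ).injective).2 h.ne_zero
  filter_upwards [eventually_aeval_ne_zero h.ne_zero, h.eventually_exists_point hFd' S hS0]
    with t₀ ht₀ ⟨x, hx, hx', hg, hxS⟩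
  have ht₀' := dotProduct_eq_zero_of_comb hA hA' (hdet' t₀ ht₀) hx hx'
  have hT : ∀ t : ℂ, aeval t δ = 0 → evalVec t P ⬝ᵥ x ≠ 0 := by
    intro t ht
    refine hxS _ (Finset.mem_union_right _ (Finset.mem_image.2 ⟨t, ?_, rfl⟩))
    rw [Multiset.mem_toFinset, mem_roots hδ0, IsRoot.def, eval_map_algebraMap, ht]
  rw [← h.card_fibres_eq hPQ hA hA' hF hFP hc hR hg
    (hxS _ (Finset.mem_union_left _ (Finset.mem_insert_self _ _)))
    (hxS _ (Finset.mem_union_left _ (Finset.mem_insert_of_mem (Finset.mem_singleton_self _))))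
    hT ht₀']
  -- Equal Plücker points give equal kernels; conversely, two fibres through the smooth point `x`
  -- have the same tangent line by `exists_minor_eq`.
  congr 1
  ext t
  have hw : ∀ (t : ℂ) (p : {p : Fin n × Fin n // p.1 < p.2}),
      aeval t (wedge A (vecDeriv A) p) = aeval t (minor A (vecDeriv A) p.1.1 p.1.2) :=
    fun _ _ => rfl
  constructor
  · rintro ⟨⟨p, hp⟩, k, hk⟩
    have hmin : ∀ i j, minor (evalVec t A) (evalVec t (vecDeriv A)) i j =
        k * minor (evalVec t₀ A) (evalVec t₀ (vecDeriv A)) i j := by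
      intro i j
      rcases lt_trichotomy i j with hij | hij | hij
      · rw [minor_evalVec, minor_evalVec]
        exact hk ⟨(i, j), hij⟩
      · subst hij
        simp [minor]
      · rw [minor_swap, minor_swap (evalVec t₀ A), minor_evalVec, minor_evalVec, mul_neg]
        exact congrArg _ (hk ⟨(j, i), hij⟩)
    have hp' := hp
    rw [hw, minor_comb' hA hA', map_mul] at hp'
    rw [hw, ← minor_evalVec] at hp
    obtain ⟨h1, h2⟩ := dotProduct_eq_zero_of_minor_eq hmin ⟨_, _, hp⟩ hx hx'
    exact dotProduct_eq_zero_of_comb hA hA' (left_ne_zero_of_mul hp') h1 h2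
  · rintro ⟨h1, h2⟩
    have ht : aeval t δ ≠ 0 := fun h0 => hT t h0 h1
    obtain ⟨k, hk⟩ := h.exists_minor_eq hF ht ht₀
      (by rw [dotProduct_comb hA, h1, h2, mul_zero, mul_zero, add_zero])
      (by rw [dotProduct_comb hA', h1, h2, mul_zero, mul_zero, add_zero]) hx hx' hg
    refine ⟨?_, k, fun p => hk _ _⟩
    obtain ⟨i, j, hij⟩ := hPQ.exists_aeval_minor_ne_zero t
    have hne : aeval t (minor A (vecDeriv A) i j) ≠ 0 := by
      rw [minor_comb' hA hA', map_mul]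
      exact mul_ne_zero (hdet' t ht) hij
    rcases lt_trichotomy i j with hij | hij | hij
    · exact ⟨⟨(i, j), hij⟩, hne⟩
    · subst hij
      simp [minor] at hne
    · refine ⟨⟨(j, i), hij⟩, fun h0 => hne ?_⟩
      rw [minor_swap, map_neg]
      exact neg_eq_zero.2 h0

/-- The implicit equation of the dual hypersurface of a curve is given by the resultant of a
`μ`-basis of the module spanned by the curve and its derivative. -/
theorem exists_implicitEquation {n : ℕ} (A : Fin n → ℝ[X])
    (hA : IsNonconstantMap (wedge A (vecDeriv A))) :
    ∃ (k : ℕ) (F : MvPolynomial (Fin n) ℝ),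
      IsParamDegree (wedge A (vecDeriv A)) k ∧ 0 < k ∧
      IsImplicitEquation (ruledHypersurface (quasiSpan A (vecDeriv A))) F ∧
      (k * F.totalDegree : ℤ) = vecDegree (wedge A (vecDeriv A)) -
        (vecGcd (wedge A (vecDeriv A))).natDegree ∧
      ∀ U V : Fin n → ℝ[X], IsMuBasis (quasiSpan A (vecDeriv A)) U V →
        k * F.totalDegree = vecDegree U + vecDegree V ∧
        ∃ c : ℝ, c ≠ 0 ∧
          resultant (linForm U) (linForm V) = MvPolynomial.C c * F ^ k := by
  obtain ⟨α, β, γ, δ, h⟩ := exists_isDualFrame hA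
  have hq : IsQuasiGenerators (quasiSpan A (vecDeriv A)) A (vecDeriv A) :=
    ⟨linearIndependent_pair_iff.2 hA.wedge_ne_zero, rfl⟩
  obtain ⟨P, Q, hPQ⟩ := exists_isRegularPair hq
  have hd := h.vecDegree_add_ne_zero hPQ
  obtain ⟨F, hFp, hFv⟩ := hPQ.exists_prime hd
  have hFP : VanishesOn P Q F := (hFv F).2 dvd_rfl
  obtain ⟨k, c, hc, hR⟩ := hPQ.exists_resultant_eq hFp hFP
  have hdeg := hPQ.mul_totalDegree_eq hFp.ne_zero hc hR
  have hk : k ≠ 0 := by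
    rintro rfl
    exact hd (by rw [← hdeg, zero_mul])
  have hFdeg : F.totalDegree ≠ 0 := by
    intro h0
    exact hd (by rw [← hdeg, h0, mul_zero])
  have hFd : ∃ i, ¬ VanishesOn P Q (MvPolynomial.pderiv i F) :=
    (exists_not_dvd_pderiv hFdeg).imp fun i hi h0 => hi ((hFv _).1 h0)
  have hgcd := hPQ.natDegree_vecGcd hq
  refine ⟨k, F, h.isParamDegree hPQ hFP hFd hc hR, Nat.pos_of_ne_zero hk, ⟨hFp.ne_zero, ?_⟩, ?_,
    fun U V hUV => ?_⟩
  · ext G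
    rw [Ideal.mem_span_singleton, ← hFv]
    exact hPQ.mem_hypersurfaceIdeal_iff (h.exists_real_point hPQ)
  · rw [hgcd, ← hdeg]
    push_cast
    ring
  · have hreg := hUV.isRegularPair
    have hUVF : VanishesOn U V F :=
      (hreg.mem_hypersurfaceIdeal_iff (h.exists_real_point hreg)).1
        ((hPQ.mem_hypersurfaceIdeal_iff (h.exists_real_point hPQ)).2 hFP)
    obtain ⟨k', c', hc', hR'⟩ := hreg.exists_resultant_eq hFp hUVF
    have hdeg' := hreg.mul_totalDegree_eq hFp.ne_zero hc' hR'
    have hsum : vecDegree P + vecDegree Q = vecDegree U + vecDegree V := by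
      rw [← hPQ.moduleDegree_eq, hreg.moduleDegree_eq]
    -- The resultant of another `μ`-basis is a power of the same `F`, and its degree `deg M` fixes
    -- the exponent.
    have hkk : k' = k := Nat.eq_of_mul_eq_mul_right (Nat.pos_of_ne_zero hFdeg) (by
      rw [hdeg, hdeg', hsum])
    exact ⟨by rw [hdeg, hsum], c', hc', hkk ▸ hR'⟩

end CanalSurface

end

/-- Independence of the curve vector and its derivative is contained in `IsNonconstantMap`: a
dependent pair has zero Plücker vector, which counts as constant. -/
theorem proposition20 (e : Fin 5 → Polynomial ℝ) :
    (CanalSurface.IsNonconstantMap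
        (CanalSurface.wedge (CanalSurface.vecE e) (CanalSurface.vecDeriv (CanalSurface.vecE e))) →
      ∃ (k : ℕ) (F : MvPolynomial (Fin 6) ℝ),
        CanalSurface.IsParamDegree
          (CanalSurface.wedge (CanalSurface.vecE e)
            (CanalSurface.vecDeriv (CanalSurface.vecE e))) k ∧
        0 < k ∧
        CanalSurface.IsImplicitEquation (CanalSurface.dualVariety e) F ∧
        (k * F.totalDegree : ℤ) =
          CanalSurface.vecDegree (CanalSurface.wedge (CanalSurface.vecE e)
            (CanalSurface.vecDeriv (CanalSurface.vecE e))) -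
          (CanalSurface.vecGcd (CanalSurface.wedge (CanalSurface.vecE e)
            (CanalSurface.vecDeriv (CanalSurface.vecE e)))).natDegree ∧
        ∀ E₁ E₂ : Fin 6 → Polynomial ℝ,
          CanalSurface.IsMuBasis (CanalSurface.moduleE e) E₁ E₂ →
          k * F.totalDegree = CanalSurface.vecDegree E₁ + CanalSurface.vecDegree E₂ ∧
          ∃ c : ℝ, c ≠ 0 ∧
            Polynomial.resultant (CanalSurface.linForm E₁) (CanalSurface.linForm E₂) =
              MvPolynomial.C c * F ^ k) ∧
    (∀ d : ℝ,
      CanalSurface.IsNonconstantMap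
        (CanalSurface.wedge (CanalSurface.vecD e d)
          (CanalSurface.vecDeriv (CanalSurface.vecD e d))) →
      ∃ (k : ℕ) (F : MvPolynomial (Fin 5) ℝ),
        CanalSurface.IsParamDegree
          (CanalSurface.wedge (CanalSurface.vecD e d)
            (CanalSurface.vecDeriv (CanalSurface.vecD e d))) k ∧
        0 < k ∧
        CanalSurface.IsImplicitEquation (CanalSurface.offsetDualVariety e d) F ∧
        (k * F.totalDegree : ℤ) =
          CanalSurface.vecDegree (CanalSurface.wedge (CanalSurface.vecD e d)
            (CanalSurface.vecDeriv (CanalSurface.vecD e d))) -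
          (CanalSurface.vecGcd (CanalSurface.wedge (CanalSurface.vecD e d)
            (CanalSurface.vecDeriv (CanalSurface.vecD e d)))).natDegree ∧
        ∀ D₁ D₂ : Fin 5 → Polynomial ℝ,
          CanalSurface.IsMuBasis (CanalSurface.moduleD e d) D₁ D₂ →
          k * F.totalDegree = CanalSurface.vecDegree D₁ + CanalSurface.vecDegree D₂ ∧
          ∃ c : ℝ, c ≠ 0 ∧
            Polynomial.resultant (CanalSurface.linForm D₁) (CanalSurface.linForm D₂) =
              MvPolynomial.C c * F ^ k) :=
  ⟨fun h => CanalSurface.exists_implicitEquation _ h,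
    fun _ h => CanalSurface.exists_implicitEquation _ h⟩
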